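/- Let $n\ge 3$, $K=\mathbb C(x_1,\dots,x_n)$ with the derivations $\partial_i=\partial/\partial x_i$. A differential extension $L\supseteq K$ is a field extension with $n$ commuting derivations $\partial_1,\dots,\partial_n$ extending those of $K$; differential forms over $L$ are forms in $dx_1,\dots,dx_n$ with coefficients in $L$, with $df=\sum_i(\partial_i f)\,dx_i$ and $d\left(\sum_i a_i\,dx_i\right)=\sum_i da_i\wedge dx_i$. The extension is called Liouvillian if $L$ and $K$ have the same constants and there is a tower $K=K_0\subseteq K_1\subseteq\dots\subseteq K_m=L$ with $K_{j+1}=K_j(t_j)$, where for each $j$ either $t_j\ne 0$ and $\partial_i t_j/t_j\in K_j$ for all $i$, or $\partial_i t_j\in K_j$ for all $i$, or $t_j$ is algebraic over $K_j$. Let $P_1,\dots,P_n\in K$ and let $$\Omega=\sum_{i=1}^n(-1)^{i-1}P_i\,dx_1\wedge\cdots\wedge\widehat{dx_i}\wedge\cdots\wedge dx_n$$ be the rational $(n-1)$-form corresponding to the rational vector field $\sum_i P_i\,\partial/\partial x_i$. A Liouvillian first integral of $\Omega$ is a non-constant element $\phi$ of some Liouvillian extension of $K$ with $d\phi\wedge\Omega=0$.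 **Theorem.** If $\Omega$ has a Liouvillian first integral, then there are a finite algebraic extension $\widetilde K$ of $K$ (with the unique extensions of the derivations of $K$) and $1$-forms $\omega\neq0$ and $\alpha$ with coefficients in $\widetilde K$ such that $$\omega\wedge\Omega=0,\qquad d\omega=\alpha\wedge\omega,\qquad d\alpha=0.$$ Consequently $\Omega$ has a Liouvillian first integral of the form $\int\omega\cdot\exp\left(-\int\alpha\right)$ with $\omega,\alpha$ defined over $\widetilde K$: there are a Liouvillian extension $M$ of $K$ that is also a differential extension of $\widetilde K$, and elements $e\neq0$ and $\psi$ of $M$, such that $de=e\,\alpha$, $d\psi=e^{-1}\omega$, and $\psi$ is a Liouvillian first integral of $\Omega$. -/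

import Mathlib

noncomputable section

namespace LiouvilleForms

/-- The structure of a differential field with `n` commuting derivations `∂/∂x₁, …, ∂/∂xₙ`
on a field `L`. -/
class PartialDiff (n : ℕ) (L : Type*) [Field L] where
  /-- the derivation `∂/∂xᵢ` -/
  pd : Fin n → Derivation ℤ L L
  pd_comm : ∀ (i j : Fin n) (a : L), pd i (pd j a) = pd j (pd i a)

open PartialDiff (pd)

/-- `L` is a differential extension of `K`: the derivations of `L` restrict to those of `K`. -/
class IsDiffExtension (n : ℕ) (K L : Type*) [Field K] [Field L] [Algebra K L]
    [PartialDiff n K] [PartialDiff n L] : Prop where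
  pd_algebraMap : ∀ (i : Fin n) (a : K), pd i (algebraMap K L a) = algebraMap K L (pd i a)

/-! ### The rational function field with its partial derivatives -/

section PartialDerivative

variable {n : ℕ} (K : Type*) [Field K] [Algebra (MvPolynomial (Fin n) ℂ) K]

/-- The ring homomorphism `p ↦ p + ε ∂p/∂xᵢ` on polynomials, with `ε ^ 2 = 0`. -/
def dualHom (i : Fin n) : MvPolynomial (Fin n) ℂ →+* TrivSqZeroExt K K where
  toFun p := TrivSqZeroExt.inl (algebraMap _ K p) +
    TrivSqZeroExt.inr (algebraMap _ K (MvPolynomial.pderiv i p))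
  map_one' := by ext <;> simp
  map_zero' := by ext <;> simp
  map_add' p q := by ext <;> simp only [map_add, TrivSqZeroExt.fst_add, TrivSqZeroExt.snd_add,
    TrivSqZeroExt.fst_inl, TrivSqZeroExt.snd_inl, TrivSqZeroExt.fst_inr, TrivSqZeroExt.snd_inr,
    add_zero, zero_add]
  map_mul' p q := by
    ext
    · simp
    · simp only [Derivation.leibniz, smul_eq_mul, map_add, map_mul, TrivSqZeroExt.snd_add,
        TrivSqZeroExt.snd_inl, TrivSqZeroExt.snd_inr, zero_add, TrivSqZeroExt.snd_mul,
        TrivSqZeroExt.fst_add, TrivSqZeroExt.fst_inl, TrivSqZeroExt.fst_inr, add_zero,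
        op_smul_eq_smul, smul_eq_mul]

variable [IsFractionRing (MvPolynomial (Fin n) ℂ) K]

/-- The extension `f ↦ f + ε ∂f/∂xᵢ` of `dualHom` to rational functions. -/
def dualLift (i : Fin n) : K →+* TrivSqZeroExt K K :=
  IsLocalization.lift (M := nonZeroDivisors (MvPolynomial (Fin n) ℂ)) (g := dualHom K i) (by
    intro y
    rw [TrivSqZeroExt.isUnit_iff_isUnit_fst]
    simp [dualHom])

theorem dualLift_algebraMap (i : Fin n) (p : MvPolynomial (Fin n) ℂ) :
    dualLift K i (algebraMap _ _ p) = dualHom K i p :=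
  IsLocalization.lift_eq _ p

theorem fst_dualLift (i : Fin n) (f : K) : (dualLift K i f).fst = f := by
  have h : ((TrivSqZeroExt.fstHom K K K).toRingHom.comp (dualLift K i)) = RingHom.id K := by
    apply IsLocalization.ringHom_ext (nonZeroDivisors (MvPolynomial (Fin n) ℂ))
    ext x <;> simp [dualLift_algebraMap, dualHom]
  exact congrArg (fun g => g f) h

/-- The partial derivative `∂/∂xᵢ` on the field of fractions of `ℂ[x₁, …, xₙ]`. -/
def fracPd (i : Fin n) : Derivation ℤ K K :=
  Derivation.mk' (AddMonoidHom.toIntLinearMap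
    { toFun := fun f => (dualLift K i f).snd
      map_zero' := by simp
      map_add' := by simp })
    (by
      intro a b
      simp [fst_dualLift, mul_comm])

theorem fracPd_algebraMap (i : Fin n) (p : MvPolynomial (Fin n) ℂ) :
    fracPd K i (algebraMap _ _ p) = algebraMap _ _ (MvPolynomial.pderiv i p) := by
  change (dualLift K i (algebraMap _ _ p)).snd = _
  rw [dualLift_algebraMap]
  change (TrivSqZeroExt.inl _ + TrivSqZeroExt.inr _ : TrivSqZeroExt K K).snd = _
  rw [TrivSqZeroExt.snd_add, TrivSqZeroExt.snd_inl, TrivSqZeroExt.snd_inr, zero_add]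

theorem fracPd_comm (i j : Fin n) (a : K) :
    fracPd K i (fracPd K j a) = fracPd K j (fracPd K i a) := by
  have key : ∀ p : MvPolynomial (Fin n) ℂ,
      ⁅fracPd K i, fracPd K j⁆ (algebraMap _ K p) = 0 := by
    intro p
    have hp : MvPolynomial.pderiv i (MvPolynomial.pderiv j p) =
        MvPolynomial.pderiv j (MvPolynomial.pderiv i p) := by
      have h : ⁅(MvPolynomial.pderiv i : Derivation ℂ (MvPolynomial (Fin n) ℂ) _),
          (MvPolynomial.pderiv j : Derivation ℂ (MvPolynomial (Fin n) ℂ) _)⁆ = 0 := by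
        refine MvPolynomial.derivation_ext fun k => ?_
        simp [Derivation.commutator_apply, MvPolynomial.pderiv_X, Pi.single_apply, apply_ite]
      have h2 := congrArg (fun D => D p) h
      simpa [Derivation.commutator_apply, sub_eq_zero] using h2
    simp [Derivation.commutator_apply, fracPd_algebraMap, hp]
  have h0 : ⁅fracPd K i, fracPd K j⁆ a = 0 := by
    obtain ⟨p, q, -, rfl⟩ := IsFractionRing.div_surjective (A := MvPolynomial (Fin n) ℂ) a
    rw [Derivation.leibniz_div]
    simp [key]
  simpa [Derivation.commutator_apply, sub_eq_zero] using h0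

end PartialDerivative

/-- The rational function field `ℂ(x₁, …, xₙ)`. -/
abbrev RatField (n : ℕ) : Type := FractionRing (MvPolynomial (Fin n) ℂ)

instance ratPartialDiff (n : ℕ) : PartialDiff n (RatField n) where
  pd := fracPd (RatField n)
  pd_comm := fracPd_comm (RatField n)

/-! ### Liouvillian extensions -/

section Liouvillian

variable (n : ℕ) (K L : Type*) [Field K] [Field L] [Algebra K L]
  [PartialDiff n K] [PartialDiff n L]

/-- The differential extension `L` of `K` has the same constants as `K`. -/
def SameConstants : Prop :=
  ∀ c : L, (∀ i : Fin n, pd i c = 0) →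
    ∃ a : K, (∀ i : Fin n, pd i a = 0) ∧ algebraMap K L a = c

/-- One step `E ⊆ E(t) = E'` of a Liouvillian tower inside `L`: the generator `t` is an
exponential of an integral, an integral, or algebraic over `E`. -/
def IsLiouvillianStep (E E' : IntermediateField K L) : Prop :=
  ∃ t : L, E' = (IntermediateField.adjoin E {t}).restrictScalars K ∧
    ((t ≠ 0 ∧ ∀ i : Fin n, pd i t / t ∈ E) ∨ (∀ i : Fin n, pd i t ∈ E) ∨ IsAlgebraic E t)

/-- `L` is a Liouvillian extension of `K`: a differential extension with the same constants
that is the top of a finite tower of Liouvillian steps starting from `K`. -/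
structure IsLiouvillianExtension : Prop where
  isDiffExtension : IsDiffExtension n K L
  sameConstants : SameConstants n K L
  exists_tower : ∃ (m : ℕ) (F : ℕ → IntermediateField K L),
    F 0 = ⊥ ∧ F m = ⊤ ∧ ∀ k < m, IsLiouvillianStep n K L (F k) (F (k + 1))

end Liouvillian

/-! ### Differential forms `∑ a_I dx_I` with coefficients in `L` -/

section Forms

variable {n : ℕ} {L : Type*} [Field L]

/-- Differential forms in `dx₁, …, dxₙ` with coefficients in `L`; the wedge product is the
multiplication of this algebra. -/
abbrev Form (n : ℕ) (L : Type*) [Field L] : Type _ := ExteriorAlgebra L (Fin n → L)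

/-- The `1`-form `∑ᵢ aᵢ dxᵢ` with coefficient vector `a`. -/
def oneForm (a : Fin n → L) : Form n L := ExteriorAlgebra.ι L a

/-- The `1`-form `dxᵢ`. -/
def dx (L : Type*) [Field L] (i : Fin n) : Form n L := oneForm (Pi.single i 1)

/-- The `(n-1)`-form
`∑ᵢ (-1)^(i-1) Pᵢ dx₁ ∧ ⋯ ∧ dxᵢ₋₁ ∧ dxᵢ₊₁ ∧ ⋯ ∧ dxₙ` (with `i` counted from `1`), which
corresponds to the vector field `∑ᵢ Pᵢ ∂/∂xᵢ`. -/
def vectorFieldForm (P : Fin n → L) : Form n L :=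
  ∑ i : Fin n, ((-1) ^ (i : ℕ) * P i) • (((List.finRange n).erase i).map (dx L)).prod

variable [PartialDiff n L]

/-- The coefficient vector of the differential `df = ∑ᵢ (∂f/∂xᵢ) dxᵢ` of `f`. -/
def grad (n : ℕ) [PartialDiff n L] (f : L) : Fin n → L := fun i => pd i f

/-- The exterior derivative `∑ᵢ daᵢ ∧ dxᵢ` of the `1`-form `∑ᵢ aᵢ dxᵢ`. -/
def dOne (a : Fin n → L) : Form n L := ∑ i : Fin n, oneForm (grad n (a i)) * dx L i

end Forms

/-- `φ`, an element of a field `L` over `K = ℂ(x₁, …, xₙ)`, is a Liouvillian first integral of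
the `(n-1)`-form given by `P`: the field `L` is a Liouvillian extension of `K`, `φ` is not
constant, and `dφ ∧ Ω = 0`. -/
structure IsLiouvillianFirstIntegral {n : ℕ} (P : Fin n → RatField n) {L : Type*} [Field L]
    [Algebra (RatField n) L] [PartialDiff n L] (φ : L) : Prop where
  isLiouvillian : IsLiouvillianExtension n (RatField n) L
  not_constant : ∃ i : Fin n, pd i φ ≠ 0
  wedge_eq_zero :
    oneForm (grad n φ) * vectorFieldForm (fun i => algebraMap (RatField n) L (P i)) = 0

end LiouvilleForms

end

open LiouvilleForms

noncomputable section

namespace LiouvilleForms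

open LiouvilleForms.PartialDiff (pd)
open Polynomial IntermediateField
open scoped WithZero

/-! ### The wedge product with the form of a vector field -/

section Wedge

variable {n : ℕ} {L : Type*} [Field L]

/-! A first integral φ gives the integrable pair (dφ, 0) over L. The task is to push a pair (ω, α)
down the tower until its coefficients are algebraic over K.

Suppose the coefficients are algebraic over G(t), with G a lower field of the tower. If t is
algebraic over G, there is nothing to do. Otherwise the pair is specialised at a place. After an
integral t is replaced by 1/t, every ∂ᵢt equals t·qᵢ(t) with qᵢ a polynomial over G, so the divisor
t = 0 is invariant. A place w of the function field G(t, ω, α) above t = 0 has residue field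
algebraic over G. In characteristic zero each ∂ᵢ is logarithmic there, that is w(∂ᵢf) ≤ w(f) in
multiplicative notation (`valuation_derivation_le`), so the derivations pass to the residue field.

The pair passes as well (`IsIntegrablePair.exists_residue`). Scaling makes ω integral with one
coefficient equal to 1, and changes α by a logarithmic differential. If α is now integral, both
forms are reduced. If α has a pole, it is divided by its largest coefficient a. As dω = α ∧ ω is
integral, (α/a) ∧ ω reduces to 0, so α/a reduces to a nonzero multiple of the reduction of ω. As α
is closed, d(α/a) = -(da/a) ∧ (α/a), and the reductions of α/a and -da/a form the new pair.

Conversely, e = exp ∫α and then ∫ω/e have to be adjoined without new constants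
(`exists_exponential`, `exists_integral`). A rational function field F(X) serves, except when the
closed form to be integrated is already exact, or when Nα = du/u for some N ≥ 1, where an N-th root
of u is used instead. Algebraic extensions add no constants because the constants are complex
numbers and ℂ is algebraically closed. -/

theorem oneForm_eq_sum_dx (a : Fin n → L) : oneForm a = ∑ i, a i • dx L i := by
  have h : a = ∑ i, a i • Pi.single i (1 : L) := by
    ext j
    simp [Finset.sum_apply, Pi.single_apply]
  conv_lhs => rw [h]
  simp [oneForm, dx, map_sum]

theorem dx_mul_dx_self (i : Fin n) : dx L i * dx L i = 0 :=
  ExteriorAlgebra.ι_sq_zero _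

theorem dx_mul_dx_swap (i j : Fin n) : dx L i * dx L j = -(dx L j * dx L i) :=
  eq_neg_of_add_eq_zero_left (ExteriorAlgebra.ι_add_mul_swap _ _)

theorem dx_mul_prod_of_mem (i : Fin n) (l : List (Fin n)) (h : i ∈ l) :
    dx L i * (l.map (dx L)).prod = 0 := by
  induction l with
  | nil => simp at h
  | cons k l ih =>
    rw [List.map_cons, List.prod_cons, ← mul_assoc]
    rcases List.mem_cons.mp h with rfl | h
    · rw [dx_mul_dx_self, zero_mul]
    · rw [dx_mul_dx_swap, neg_mul, mul_assoc, ih h, mul_zero, neg_zero]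

theorem dx_mul_prod_erase (i : Fin n) (l : List (Fin n)) (h : i ∈ l) :
    dx L i * ((l.erase i).map (dx L)).prod =
      (-1 : L) ^ (l.idxOf i) • (l.map (dx L)).prod := by
  induction l with
  | nil => simp at h
  | cons k l ih =>
    by_cases hk : k = i
    · subst hk
      simp
    · have hl : i ∈ l := by
        rcases List.mem_cons.mp h with rfl | h
        · exact absurd rfl hk
        · exact h
      rw [List.erase_cons_tail (by simpa using hk), List.idxOf_cons_ne _ hk, List.map_cons,
        List.prod_cons, ← mul_assoc, dx_mul_dx_swap, neg_mul, mul_assoc, ih hl, List.map_cons,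
        List.prod_cons, pow_succ]
      simp

/-- The volume form `dx₁ ∧ ⋯ ∧ dxₙ`. -/
def volumeForm (n : ℕ) (L : Type*) [Field L] : Form n L := ((List.finRange n).map (dx L)).prod

/-- Moving dxᵢ back to its place costs the sign (-1)^i, which cancels the sign in Ω. Thus wedging
with Ω is contraction with the vector field. -/
theorem oneForm_mul_vectorFieldForm (a P : Fin n → L) :
    oneForm a * vectorFieldForm P = (∑ i, a i * P i) • volumeForm n L := by
  have key : ∀ i j : Fin n,
      dx L i * (((List.finRange n).erase j).map (dx L)).prod =
        if i = j then (-1 : L) ^ (j : ℕ) • volumeForm n L else 0 := by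
    intro i j
    split_ifs with h
    · subst h
      rw [dx_mul_prod_erase i _ (List.mem_finRange i), List.idxOf_finRange]
      rfl
    · exact dx_mul_prod_of_mem i _ ((List.mem_erase_of_ne h).mpr (List.mem_finRange i))
  rw [oneForm_eq_sum_dx, vectorFieldForm, Finset.sum_mul_sum, Finset.sum_smul]
  refine Finset.sum_congr rfl fun i _ => ?_
  simp only [smul_mul_assoc, mul_smul_comm, key]
  rw [Finset.sum_eq_single i (fun j _ hj => by simp [Ne.symm hj]) (by simp)]
  simp only [if_true, smul_smul]
  congr 1
  rw [mul_comm ((-1) ^ (i : ℕ)) (P i), mul_mul_mul_comm, ← pow_add, Even.neg_one_pow ⟨_, rfl⟩,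
    mul_one, mul_comm]

theorem volumeForm_ne_zero (n : ℕ) (L : Type*) [Field L] : volumeForm n L ≠ 0 := by
  intro h
  have h1 : volumeForm n L = ExteriorAlgebra.ιMulti L n (Pi.basisFun L (Fin n)) := by
    rw [ExteriorAlgebra.ιMulti_apply, volumeForm, ← List.ofFn_eq_map]
    congr 2
    ext i
    simp [dx, oneForm]
  -- The functional that is the determinant in degree n and zero in other degrees takes the value 1
  -- on the volume form.
  have h2 := congrArg (ExteriorAlgebra.liftAlternating (R := L) (M := Fin n → L) (N := L)
    (fun i => if h : n = i then h ▸ (Pi.basisFun L (Fin n)).det else 0)) (h1.symm.trans h)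
  rw [ExteriorAlgebra.liftAlternating_apply_ιMulti, map_zero] at h2
  simp only [dif_pos] at h2
  rw [Module.Basis.det_self] at h2
  exact one_ne_zero h2

theorem oneForm_mul_vectorFieldForm_eq_zero_iff (a P : Fin n → L) :
    oneForm a * vectorFieldForm P = 0 ↔ ∑ i, a i * P i = 0 := by
  rw [oneForm_mul_vectorFieldForm, smul_eq_zero, or_iff_left (volumeForm_ne_zero n L)]

theorem oneForm_mul_oneForm (a b : Fin n → L) :
    oneForm a * oneForm b = ∑ i, ∑ j, (a i * b j) • (dx L i * dx L j) := by
  rw [oneForm_eq_sum_dx, oneForm_eq_sum_dx b, Finset.sum_mul_sum]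
  simp only [smul_mul_smul_comm]

/-- A two-form is determined by the antisymmetric part of its matrix of coefficients. -/
theorem sum_smul_dx_mul_dx_congr [CharZero L] (a b : Fin n → Fin n → L)
    (h : ∀ i j, a i j - a j i = b i j - b j i) :
    ∑ i, ∑ j, a i j • (dx L i * dx L j) = ∑ i, ∑ j, b i j • (dx L i * dx L j) := by
  -- Twice the form involves only the antisymmetric part; characteristic zero then permits division
  -- by two.
  have key : ∀ c : Fin n → Fin n → L, (2 : L) • ∑ i, ∑ j, c i j • (dx L i * dx L j) =
      ∑ i, ∑ j, (c i j - c j i) • (dx L i * dx L j) := by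
    intro c
    have h2 : ∑ i, ∑ j, c i j • (dx L i * dx L j) =
        ∑ i, ∑ j, (-c j i) • (dx L i * dx L j) := by
      rw [Finset.sum_comm]
      refine Finset.sum_congr rfl fun i _ => Finset.sum_congr rfl fun j _ => ?_
      rw [dx_mul_dx_swap, smul_neg, neg_smul]
    rw [two_smul]
    nth_rewrite 2 [h2]
    rw [← Finset.sum_add_distrib]
    refine Finset.sum_congr rfl fun i _ => ?_
    rw [← Finset.sum_add_distrib]
    refine Finset.sum_congr rfl fun j _ => ?_
    rw [← add_smul, sub_eq_add_neg]
  have h3 := (key a).trans ((by simp only [h]) : _ = _) |>.trans (key b).symm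
  exact smul_right_injective _ (two_ne_zero (α := L)) h3

end Wedge

/-! ### Integrable pairs of one-forms -/

section Pair

variable {n : ℕ} {L : Type*} [Field L] [PartialDiff n L]

/-- The one-forms `ω ≠ 0` and `α` satisfy `ω ∧ Ω = 0`, `dω = α ∧ ω` and `dα = 0`, written in
coordinates. -/
structure IsIntegrablePair (P ω α : Fin n → L) : Prop where
  ne_zero : ω ≠ 0
  sum_mul_eq_zero : ∑ i, ω i * P i = 0
  d_fst : ∀ i j, pd i (ω j) - pd j (ω i) = α i * ω j - α j * ω i
  d_snd : ∀ i j, pd i (α j) = pd j (α i)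

theorem dOne_eq_sum (a : Fin n → L) :
    dOne a = ∑ i, ∑ j, pd i (a j) • (dx L i * dx L j) := by
  rw [dOne, Finset.sum_comm]
  refine Finset.sum_congr rfl fun i _ => ?_
  rw [oneForm_eq_sum_dx, Finset.sum_mul]
  simp [grad]

theorem IsIntegrablePair.oneForm_mul {P ω α : Fin n → L} (h : IsIntegrablePair P ω α) :
    oneForm ω * vectorFieldForm P = 0 :=
  (oneForm_mul_vectorFieldForm_eq_zero_iff ω P).mpr h.sum_mul_eq_zero

theorem IsIntegrablePair.dOne_fst [CharZero L] {P ω α : Fin n → L}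
    (h : IsIntegrablePair P ω α) : dOne ω = oneForm α * oneForm ω := by
  rw [dOne_eq_sum, oneForm_mul_oneForm]
  exact sum_smul_dx_mul_dx_congr _ _ fun i j => by rw [h.d_fst]

theorem IsIntegrablePair.dOne_snd [CharZero L] {P ω α : Fin n → L}
    (h : IsIntegrablePair P ω α) : dOne α = 0 := by
  rw [dOne_eq_sum, sum_smul_dx_mul_dx_congr _ (fun _ _ => 0) fun i j => by rw [h.d_snd]; simp]
  simp

/-- An exact form annihilated by the vector field gives an integrable pair. -/
theorem IsIntegrablePair.of_grad {P : Fin n → L} {φ : L} (h0 : ∃ i : Fin n, pd i φ ≠ 0)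
    (h : oneForm (grad n φ) * vectorFieldForm P = 0) : IsIntegrablePair P (grad n φ) 0 where
  ne_zero := fun h' => by
    obtain ⟨i, hi⟩ := h0
    exact hi (congrFun h' i)
  sum_mul_eq_zero := (oneForm_mul_vectorFieldForm_eq_zero_iff _ P).mp h
  d_fst i j := by simp [grad, PartialDiff.pd_comm i j]
  d_snd i j := by simp

theorem pd_div (i : Fin n) (a b : L) (hb : b ≠ 0) :
    pd i (a / b) = pd i a / b - a * (pd i b / b) / b := by
  rw [Derivation.leibniz_div]
  simp only [smul_eq_mul]
  field_simp

/-- Logarithmic differentials are closed. -/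
theorem pd_logDeriv_comm (i j : Fin n) (u : L) (hu : u ≠ 0) :
    pd i (pd j u / u) = pd j (pd i u / u) := by
  rw [pd_div _ _ _ hu, pd_div _ _ _ hu, PartialDiff.pd_comm i j]
  ring

/-- Change of gauge: d(ω/u) = (α - du/u) ∧ (ω/u), and du/u is closed. This gives the freedom to
normalise ω at a place. -/
theorem IsIntegrablePair.div {P ω α : Fin n → L} (h : IsIntegrablePair P ω α) {u : L}
    (hu : u ≠ 0) :
    IsIntegrablePair P (fun i => ω i / u) (fun i => α i - pd i u / u) where
  ne_zero := fun h' => h.ne_zero <| by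
    ext i
    have := congrFun h' i
    simpa [hu] using this
  sum_mul_eq_zero := by
    have : ∑ i, ω i / u * P i = (∑ i, ω i * P i) / u := by
      rw [Finset.sum_div]
      exact Finset.sum_congr rfl fun i _ => by ring
    rw [this, h.sum_mul_eq_zero, zero_div]
  d_fst i j := by
    rw [pd_div _ _ _ hu, pd_div _ _ _ hu]
    have := h.d_fst i j
    field_simp
    linear_combination u * this
  d_snd i j := by
    rw [map_sub, map_sub, pd_logDeriv_comm i j u hu, h.d_snd]

/-- The image of an integrable pair under a differential homomorphism of fields. -/
theorem IsIntegrablePair.map {L' : Type*} [Field L'] [PartialDiff n L'] (f : L →+* L')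
    (hf : ∀ (i : Fin n) a, pd i (f a) = f (pd i a)) {P ω α : Fin n → L} (h : IsIntegrablePair P ω α) :
    IsIntegrablePair (f ∘ P) (f ∘ ω) (f ∘ α) where
  ne_zero := fun h' => h.ne_zero <| by
    ext i
    have := congrFun h' i
    simpa using this
  sum_mul_eq_zero := by
    have := congrArg f h.sum_mul_eq_zero
    simpa using this
  d_fst i j := by simp only [Function.comp, hf, ← map_mul, ← map_sub, h.d_fst]
  d_snd i j := by simp only [Function.comp, hf, h.d_snd i j]

/-- All the conditions are equations and a nonvanishing, which an injective map reflects. It serves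
to restrict a pair to a differential subfield containing its coefficients. -/
theorem IsIntegrablePair.of_map {L' : Type*} [Field L'] [PartialDiff n L'] (f : L →+* L')
    (hf : ∀ (i : Fin n) a, pd i (f a) = f (pd i a)) {P ω α : Fin n → L}
    (h : IsIntegrablePair (f ∘ P) (f ∘ ω) (f ∘ α)) : IsIntegrablePair P ω α where
  ne_zero := fun h' => h.ne_zero <| by
    ext i
    simp [h']
  sum_mul_eq_zero := by
    apply f.injective
    simpa using h.sum_mul_eq_zero
  d_fst i j := by
    apply f.injective
    simpa [hf] using h.d_fst i j
  d_snd i j := by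
    apply f.injective
    simpa [hf] using h.d_snd i j

end Pair

/-! ### Derivations and algebraic elements -/

section CoeffDeriv

variable {F E : Type*} [Field F] [Field E] [Algebra F E]

/-- The derivation of `F[X]` that applies a derivation of `F` to the coefficients. -/
def coeffDeriv (d : Derivation ℤ F F) : Derivation ℤ F[X] F[X] :=
  letI : Differential F := ⟨d⟩
  Differential.mapCoeffs

@[simp]
theorem coeff_coeffDeriv (d : Derivation ℤ F F) (p : F[X]) (k : ℕ) :
    (coeffDeriv d p).coeff k = d (p.coeff k) := rfl

theorem derivation_aeval {d : Derivation ℤ F F} {D : Derivation ℤ E E}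
    (h : ∀ a, D (algebraMap F E a) = algebraMap F E (d a)) (x : E) (p : F[X]) :
    D (aeval x p) = aeval x (coeffDeriv d p) + aeval x (derivative p) * D x := by
  let : Differential F := ⟨d⟩
  let : Differential E := ⟨D⟩
  have : DifferentialAlgebra F E := ⟨h⟩
  exact Differential.deriv_aeval_eq x p

theorem aeval_derivative_minpoly_ne_zero [CharZero F] {x : E} (hx : IsAlgebraic F x) :
    aeval x (derivative (minpoly F x)) ≠ 0 :=
  (minpoly.irreducible hx.isIntegral).separable.aeval_derivative_ne_zero (minpoly.aeval F x)

/-- Derivations of an algebraic extension are determined by their values on the base. -/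
theorem derivation_eq_of_isAlgebraic [CharZero F] {D D' : Derivation ℤ E E}
    (h : ∀ a, D (algebraMap F E a) = D' (algebraMap F E a)) {x : E} (hx : IsAlgebraic F x) :
    D x = D' x := by
  have h0 : ∀ a, (D - D') (algebraMap F E a) = algebraMap F E ((0 : Derivation ℤ F F) a) := by
    intro a
    simp [h]
  have h1 := derivation_aeval h0 x (minpoly F x)
  have h2 : coeffDeriv (0 : Derivation ℤ F F) (minpoly F x) = 0 := by
    ext k
    simp
  rw [minpoly.aeval, map_zero, h2, map_zero, zero_add] at h1
  have h3 := (mul_eq_zero.mp h1.symm).resolve_left (aeval_derivative_minpoly_ne_zero hx)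
  simpa [sub_eq_zero] using h3

end CoeffDeriv

/-! ### Differential subfields -/

section Stable

variable {n : ℕ} {F E : Type*} [Field F] [Field E] [Algebra F E]

/-- An intermediate field stable under the derivations is a differential field. -/
@[reducible]
def PartialDiff.restrict [PartialDiff n E] (G : IntermediateField F E)
    (hG : ∀ (i : Fin n), ∀ x ∈ G, pd i x ∈ G) : PartialDiff n G where
  pd i := Derivation.mk' (AddMonoidHom.toIntLinearMap
    { toFun := fun x => ⟨pd i (x : E), hG i x x.2⟩
      map_zero' := by ext; simp
      map_add' := fun x y => by ext; simp })
    (fun a b => by ext; simp)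
  pd_comm i j a := by
    ext
    exact PartialDiff.pd_comm i j (a : E)

theorem isDiffExtension_restrict [PartialDiff n E] (G : IntermediateField F E)
    (hG : ∀ (i : Fin n), ∀ x ∈ G, pd i x ∈ G) :
    letI := PartialDiff.restrict G hG
    IsDiffExtension n G E :=
  letI := PartialDiff.restrict G hG
  ⟨fun _ _ => rfl⟩

theorem isDiffExtension_base_restrict [PartialDiff n F] [PartialDiff n E] [IsDiffExtension n F E]
    (G : IntermediateField F E) (hG : ∀ (i : Fin n), ∀ x ∈ G, pd i x ∈ G) :
    letI := PartialDiff.restrict G hG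
    IsDiffExtension n F G :=
  letI := PartialDiff.restrict G hG
  ⟨fun i a => Subtype.ext (IsDiffExtension.pd_algebraMap i a : pd i (algebraMap F E a) = _)⟩

theorem IsDiffExtension.trans {F E M : Type*} [Field F] [Field E] [Field M] [Algebra F E]
    [Algebra E M] [Algebra F M] [IsScalarTower F E M] [PartialDiff n F] [PartialDiff n E]
    [PartialDiff n M] [IsDiffExtension n F E] [IsDiffExtension n E M] :
    IsDiffExtension n F M where
  pd_algebraMap i a := by
    rw [IsScalarTower.algebraMap_apply F E M, IsDiffExtension.pd_algebraMap,
      IsDiffExtension.pd_algebraMap, ← IsScalarTower.algebraMap_apply]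

/-- Differentiating the minimal equation of x expresses ∂x as a rational function of x over G; the
denominator is nonzero by separability. -/
theorem pd_mem_of_isAlgebraic [CharZero F] [PartialDiff n E] {G H : IntermediateField F E}
    (hGH : G ≤ H) (hG : ∀ (i : Fin n), ∀ x ∈ G, pd i x ∈ G) {x : E} (hx : IsAlgebraic G x)
    (hxH : x ∈ H) (i : Fin n) : pd i x ∈ H := by
  let := PartialDiff.restrict G hG
  have := isDiffExtension_restrict G hG
  have : CharZero G := charZero_of_injective_algebraMap (algebraMap F G).injective
  have h1 := derivation_aeval (IsDiffExtension.pd_algebraMap (K := G) (L := E) i) x (minpoly G x)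
  rw [minpoly.aeval, map_zero] at h1
  have h2 := aeval_derivative_minpoly_ne_zero hx
  have h3 : ∀ p : G[X], aeval x p ∈ H := by
    intro p
    rw [aeval_eq_sum_range]
    refine sum_mem fun k _ => ?_
    rw [Algebra.smul_def]
    exact mul_mem (hGH (p.coeff k).2) (pow_mem hxH k)
  have h4 : pd i x = -aeval x (coeffDeriv (pd i) (minpoly G x)) /
      aeval x (derivative (minpoly G x)) := by
    rw [eq_div_iff h2]
    linear_combination -h1
  rw [h4]
  exact div_mem (neg_mem (h3 _)) (h3 _)

theorem pd_mem_adjoin [PartialDiff n F] [PartialDiff n E] [IsDiffExtension n F E] {T : Set E}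
    (hT : ∀ (i : Fin n), ∀ x ∈ T, pd i x ∈ adjoin F T) (i : Fin n) {x : E}
    (hx : x ∈ adjoin F T) : pd i x ∈ adjoin F T := by
  induction hx using adjoin_induction with
  | mem x hx => exact hT i x hx
  | algebraMap a =>
    rw [IsDiffExtension.pd_algebraMap]
    exact IntermediateField.algebraMap_mem _ _
  | add x y _ _ hx hy => rw [map_add]; exact add_mem hx hy
  | inv x hx' hx =>
    rw [Derivation.leibniz_inv]
    exact mul_mem (neg_mem (pow_mem (inv_mem hx') 2)) hx
  | mul x y hx' hy' hx hy =>
    rw [Derivation.leibniz]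
    exact add_mem (mul_mem hx' hy) (mul_mem hy' hx)

theorem pd_mem_adjoin_of_isAlgebraic [CharZero F] [PartialDiff n F] [PartialDiff n E]
    [IsDiffExtension n F E] {T : Set E} {G : IntermediateField F E} (hGT : G ≤ adjoin F T)
    (hG : ∀ (i : Fin n), ∀ x ∈ G, pd i x ∈ G) (hT : ∀ x ∈ T, IsAlgebraic G x) (i : Fin n) {x : E}
    (hx : x ∈ adjoin F T) : pd i x ∈ adjoin F T :=
  pd_mem_adjoin (fun i x hx => pd_mem_of_isAlgebraic hGT hG (hT x hx) (subset_adjoin F T hx) i)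
    i hx

theorem pd_mem_bot [PartialDiff n F] [PartialDiff n E] [IsDiffExtension n F E] (i : Fin n)
    (x : E) (hx : x ∈ (⊥ : IntermediateField F E)) : pd i x ∈ (⊥ : IntermediateField F E) := by
  obtain ⟨a, rfl⟩ := mem_bot.mp hx
  rw [IsDiffExtension.pd_algebraMap]
  exact IntermediateField.algebraMap_mem _ _

end Stable

/-! ### Constants of algebraic extensions -/

section Constants

variable {n : ℕ} {F E : Type*} [Field F] [Field E] [Algebra F E] [PartialDiff n F]
  [PartialDiff n E] [IsDiffExtension n F E]

/-- All constants of `F` are in the image of the complex numbers. -/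
def HasComplexConstants (n : ℕ) (F : Type*) [Field F] [PartialDiff n F] : Prop :=
  ∃ ι : ℂ →+* F, ∀ c : F, (∀ i : Fin n, pd i c = 0) → c ∈ ι.range

theorem HasComplexConstants.of_sameConstants {F E : Type*} [Field F] [Field E] [Algebra F E]
    [PartialDiff n F] [PartialDiff n E] (hF : HasComplexConstants n F)
    (h : SameConstants n F E) : HasComplexConstants n E := by
  obtain ⟨ι, hι⟩ := hF
  refine ⟨(algebraMap F E).comp ι, fun c hc => ?_⟩
  obtain ⟨a, ha, rfl⟩ := h c hc
  obtain ⟨z, rfl⟩ := hι a ha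
  exact ⟨z, rfl⟩

/-- The minimal polynomial of a constant has constant, hence complex, coefficients. It therefore has
a complex root, and being irreducible it is linear. -/
theorem sameConstants_of_isAlgebraic [Algebra.IsAlgebraic F E] (hF : HasComplexConstants n F) :
    SameConstants n F E := by
  obtain ⟨ι, hι⟩ := hF
  intro c hc
  have hint : IsIntegral F c := (Algebra.IsAlgebraic.isAlgebraic c).isIntegral
  have hconst : ∀ (i : Fin n) (k : ℕ), pd i ((minpoly F c).coeff k) = 0 := by
    intro i k
    have h1 := derivation_aeval (IsDiffExtension.pd_algebraMap (K := F) (L := E) i) c (minpoly F c)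
    rw [minpoly.aeval, map_zero, hc i, mul_zero, add_zero] at h1
    -- The differentiated polynomial still kills c, and since the leading coefficient 1 has
    -- derivative 0 its degree is too small for it to be nonzero.
    have h2 : coeffDeriv (pd i) (minpoly F c) = 0 := by
      by_contra hne
      refine absurd (minpoly.degree_le_of_ne_zero F c hne h1.symm) (not_le.mpr ?_)
      rw [degree_eq_natDegree (minpoly.ne_zero hint), degree_lt_iff_coeff_zero]
      intro m hm
      rw [coeff_coeffDeriv]
      rcases hm.eq_or_lt with rfl | hm
      · rw [(minpoly.monic hint).coeff_natDegree, Derivation.map_one_eq_zero]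
      · rw [coeff_eq_zero_of_natDegree_lt hm, map_zero]
    rw [← coeff_coeffDeriv, h2, coeff_zero]
  have hlift : minpoly F c ∈ Polynomial.lifts ι := by
    rw [Polynomial.lifts_iff_coeff_lifts]
    intro k
    exact hι _ fun i => hconst i k
  obtain ⟨q, hq⟩ := hlift
  have hq : q.map ι = minpoly F c := hq
  have hdeg : q.degree ≠ 0 := by
    rw [← degree_map q ι, hq]
    exact (minpoly.degree_pos hint).ne'
  obtain ⟨z, hz⟩ := IsAlgClosed.exists_root q hdeg
  have hroot : (minpoly F c).IsRoot (ι z) := by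
    rw [← hq]
    exact hz.map
  have hdeg1 := degree_eq_one_of_irreducible_of_root (minpoly.irreducible hint) hroot
  obtain ⟨a, ha⟩ := minpoly.mem_range_of_degree_eq_one F c hdeg1
  refine ⟨a, fun i => ?_, ha⟩
  apply (algebraMap F E).injective
  rw [← IsDiffExtension.pd_algebraMap, ha, hc, map_zero]

end Constants

/-! ### Derivations that are logarithmic along a discrete valuation -/

section LogContractive

variable {F E : Type*} [Field F] [Field E] [Algebra F E]

theorem derivation_zpow_mul_div {D : Derivation ℤ E E} {a u : E} (ha : a ≠ 0) (hu : u ≠ 0)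
    (k : ℤ) : D (a ^ k * u) / (a ^ k * u) = k * (D a / a) + D u / u := by
  rw [Derivation.leibniz, Derivation.leibniz_zpow]
  simp only [smul_eq_mul, zsmul_eq_mul]
  rw [zpow_sub_one₀ ha]
  field_simp
  ring

theorem exists_eq_zpow_mul_of_valuation {w : Valuation E ℤᵐ⁰} {a : E} (ha : w a = WithZero.exp (-1))
    {f : E} (hf : f ≠ 0) : ∃ (k : ℤ) (u : E), u ≠ 0 ∧ w u = 1 ∧ f = a ^ k * u := by
  have ha0 : a ≠ 0 := fun h => by
    rw [h, map_zero] at ha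
    exact WithZero.exp_ne_zero ha.symm
  have hw : w f ≠ 0 := (Valuation.ne_zero_iff w).mpr hf
  refine ⟨-WithZero.log (w f), f / a ^ (-WithZero.log (w f)), ?_, ?_, ?_⟩
  · exact div_ne_zero hf (zpow_ne_zero _ ha0)
  · rw [map_div₀, map_zpow₀, ha, ← WithZero.exp_zsmul, div_eq_one_iff_eq (by simp)]
    conv_lhs => rw [← WithZero.exp_log hw]
    simp
  · field_simp

/-- A derivation that preserves a discrete valuation ring of residue characteristic zero and is
logarithmic along one element of positive valuation is logarithmic. -/
theorem valuation_derivation_le_of_integral (w : Valuation E ℤᵐ⁰)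
    (hw : ∀ m : ℤ, m ≠ 0 → w (m : E) = 1) {a t : E} (ha : w a = WithZero.exp (-1)) (ht0 : t ≠ 0)
    (ht : w t < 1) (D : Derivation ℤ E E) (hD : ∀ x, w x ≤ 1 → w (D x) ≤ 1) (hDt : w (D t) ≤ w t)
    (f : E) : w (D f) ≤ w f := by
  have ha0 : a ≠ 0 := fun h => by
    rw [h, map_zero] at ha
    exact WithZero.exp_ne_zero ha.symm
  have hint : ∀ m : ℤ, w (m : E) ≤ 1 := by
    intro m
    rcases eq_or_ne m 0 with rfl | h
    · simp
    · exact (hw m h).le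
  have hunit : ∀ u, w u = 1 → w (D u / u) ≤ 1 := by
    intro u hu
    rw [map_div₀, hu, div_one]
    exact hD u hu.le
  have hle : ∀ x, x ≠ 0 → (w (D x) ≤ w x ↔ w (D x / x) ≤ 1) := by
    intro x hx
    rw [map_div₀, div_le_one₀]
    exact zero_lt_iff.mpr ((Valuation.ne_zero_iff w).mpr hx)
  have hDa : w (D a / a) ≤ 1 := by
    obtain ⟨k, u, hu0, hu, rfl⟩ := exists_eq_zpow_mul_of_valuation ha ht0
    have hk : k ≠ 0 := by
      rintro rfl
      simp [hu] at ht
    -- With t = a^k u and k ≠ 0, integrality of Dt/t and Du/u gives that of k·Da/a, and the integer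
    -- k is a unit.
    have h1 : (k : E) * (D a / a) = D (a ^ k * u) / (a ^ k * u) - D u / u := by
      rw [derivation_zpow_mul_div ha0 hu0]
      ring
    have h2 : w ((k : E) * (D a / a)) ≤ 1 := by
      rw [h1]
      exact (w.map_sub _ _).trans (max_le ((hle _ ht0).mp hDt) (hunit u hu))
    rwa [map_mul, hw k hk, one_mul] at h2
  rcases eq_or_ne f 0 with rfl | hf
  · simp
  rw [hle f hf]
  obtain ⟨k, u, hu0, hu, rfl⟩ := exists_eq_zpow_mul_of_valuation ha hf
  rw [derivation_zpow_mul_div ha0 hu0]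
  refine (w.map_add _ _).trans (max_le ?_ (hunit u hu))
  rw [map_mul]
  exact mul_le_one' (hint k) hDa

theorem valuation_aeval_le_one {Γ : Type*} [LinearOrderedCommGroupWithZero Γ] {w : Valuation E Γ}
    (hF : ∀ a : F, a ≠ 0 → w (algebraMap F E a) = 1) {x : E} (hx : w x ≤ 1) (p : F[X]) :
    w (aeval x p) ≤ 1 := by
  rw [aeval_eq_sum_range]
  refine w.map_sum_le fun k _ => ?_
  rw [Algebra.smul_def, map_mul, map_pow]
  refine mul_le_one' ?_ (pow_le_one' hx k)
  rcases eq_or_ne (p.coeff k) 0 with h | h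
  · simp [h]
  · exact (hF _ h).le

/-- A nonzero p of least degree that vanishes at the residue of x is separable there: its derivative
is nonzero of smaller degree, so it cannot vanish at that residue. -/
theorem exists_valuation_aeval_lt_one_and_derivative [CharZero F] {Γ : Type*}
    [LinearOrderedCommGroupWithZero Γ] {w : Valuation E Γ}
    (hF : ∀ a : F, a ≠ 0 → w (algebraMap F E a) = 1) {x : E} (hx : w x ≤ 1)
    (h : ∃ p : F[X], p ≠ 0 ∧ w (aeval x p) < 1) :
    ∃ p : F[X], w (aeval x p) < 1 ∧ w (aeval x (derivative p)) = 1 := by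
  classical
  have h' : ∃ k : ℕ, ∃ p : F[X], p.natDegree = k ∧ p ≠ 0 ∧ w (aeval x p) < 1 := by
    obtain ⟨p, hp⟩ := h
    exact ⟨_, p, rfl, hp⟩
  obtain ⟨p, hpk, hp0, hp⟩ := Nat.find_spec h'
  have hmin : ∀ q : F[X], q.natDegree < p.natDegree → q ≠ 0 → ¬ w (aeval x q) < 1 :=
    fun q hq hq0 hq1 => Nat.find_min h' (hpk ▸ hq) ⟨q, rfl, hq0, hq1⟩
  have hdeg : p.natDegree ≠ 0 := by
    intro h0
    rw [eq_C_of_natDegree_eq_zero h0] at hp hp0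
    rw [aeval_C, hF _ (by simpa using hp0)] at hp
    exact lt_irrefl _ hp
  refine ⟨p, hp, le_antisymm (valuation_aeval_le_one hF hx _) (not_lt.mp ?_)⟩
  refine hmin _ (natDegree_derivative_lt hdeg) fun h0 => hdeg ?_
  exact derivative_eq_zero.mp h0

/-- A derivation with poles bounded on a discrete valuation ring whose residue field is algebraic
over a subfield stable under the derivation is logarithmic if it is so along one element of
positive valuation. -/
theorem valuation_derivation_le [CharZero F] (w : Valuation E ℤᵐ⁰)
    (hF : ∀ a : F, a ≠ 0 → w (algebraMap F E a) = 1) {a t : E} (ha : w a = WithZero.exp (-1))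
    (ht0 : t ≠ 0) (ht : w t < 1) (hres : ∀ x, w x ≤ 1 → ∃ p : F[X], p ≠ 0 ∧ w (aeval x p) < 1)
    {d : Derivation ℤ F F} {D : Derivation ℤ E E}
    (hd : ∀ a, D (algebraMap F E a) = algebraMap F E (d a)) (hDt : w (D t) ≤ w t) (N : ℕ)
    (hN : ∀ x, w x ≤ 1 → w (D x) ≤ WithZero.exp (N : ℤ)) (f : E) : w (D f) ≤ w f := by
  have hw : ∀ m : ℤ, m ≠ 0 → w (m : E) = 1 := by
    intro m hm
    rw [← map_intCast (algebraMap F E)]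
    exact hF _ (by exact_mod_cast hm)
  induction N with
  | zero =>
    exact valuation_derivation_le_of_integral w hw ha ht0 ht D (by simpa using hN) hDt f
  | succ N ih =>
    -- The pole bound is lowered by one. The derivation a^(N+1)·D preserves integrality, hence is
    -- logarithmic. Applied to p(x), where p(x) reduces to 0 and p'(x) is a unit, it shows that
    -- a^(N+1)·Dx has positive order, so the pole of Dx has order at most N.
    refine ih fun x hx => ?_
    have hpow : w (a ^ (N + 1)) = WithZero.exp (-(N + 1 : ℤ)) := by
      rw [map_pow, ha, ← WithZero.exp_nsmul]
      simp
    have hpow1 : w (a ^ (N + 1)) < 1 := by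
      rw [hpow, ← WithZero.exp_zero, WithZero.exp_lt_exp]
      omega
    have hD : ∀ y, w ((a ^ (N + 1) • D) y) ≤ w y := by
      refine valuation_derivation_le_of_integral w hw ha ht0 ht _ (fun y hy => ?_) ?_
      · rw [Derivation.smul_apply, smul_eq_mul, map_mul, hpow]
        refine (mul_le_mul_right (hN y hy) _).trans ?_
        rw [← WithZero.exp_add]
        simp
      · rw [Derivation.smul_apply, smul_eq_mul, map_mul]
        exact (mul_le_of_le_one_left' hpow1.le).trans hDt
    obtain ⟨p, hp, hp'⟩ := exists_valuation_aeval_lt_one_and_derivative hF hx (hres x hx)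
    have h1 := hD (aeval x p)
    rw [Derivation.smul_apply, smul_eq_mul, derivation_aeval hd] at h1
    have h2 : w (a ^ (N + 1) * D x) < 1 := by
      have h3 : w (aeval x (derivative p) * (a ^ (N + 1) * D x)) < 1 := by
        have h4 : aeval x (derivative p) * (a ^ (N + 1) * D x) =
            a ^ (N + 1) * (aeval x (coeffDeriv d p) + aeval x (derivative p) * D x) -
              a ^ (N + 1) * aeval x (coeffDeriv d p) := by ring
        rw [h4]
        refine (w.map_sub _ _).trans_lt (max_lt (h1.trans_lt hp) ?_)
        rw [map_mul]
        exact mul_lt_one_of_lt_of_le hpow1 (valuation_aeval_le_one hF hx _)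
      rwa [map_mul, hp', one_mul] at h3
    rw [map_mul, hpow] at h2
    rcases eq_or_ne (w (D x)) 0 with h0 | h0
    · rw [h0]
      exact zero_le
    · rw [← WithZero.exp_log h0, ← WithZero.exp_add, ← WithZero.exp_zero, WithZero.exp_lt_exp] at h2
      rw [← WithZero.exp_log h0, WithZero.exp_le_exp]
      omega

end LogContractive

/-! ### Reduction of integrable pairs to the residue field -/

section Residue

variable {n : ℕ} {E Γ : Type*} [Field E] [PartialDiff n E] [LinearOrderedCommGroupWithZero Γ]

/-- The residue field of a valuation. -/
abbrev ValuationResidue (w : Valuation E Γ) : Type _ := IsLocalRing.ResidueField w.valuationSubring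

/-- The residue class of an integral element. -/
abbrev residueClass (w : Valuation E Γ) : w.valuationSubring →+* ValuationResidue w :=
  IsLocalRing.residue w.valuationSubring

theorem residueClass_eq_zero_iff (w : Valuation E Γ) (x : w.valuationSubring) :
    residueClass w x = 0 ↔ w (x : E) < 1 := by
  rw [IsLocalRing.residue_eq_zero_iff, IsLocalRing.mem_maximalIdeal, mem_nonunits_iff, not_iff_comm,
    not_lt]
  constructor
  · intro h
    have hx0 : (x : E) ≠ 0 := fun h0 => by simp [h0] at h
    have hinv : (x : E)⁻¹ ∈ w.valuationSubring := by
      rw [Valuation.mem_valuationSubring_iff, map_inv₀]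
      exact inv_le_one_of_one_le₀ h
    exact IsUnit.of_mul_eq_one ⟨_, hinv⟩ (Subtype.ext (mul_inv_cancel₀ hx0))
  · rintro ⟨u, rfl⟩
    have h1 : w ((u : w.valuationSubring) : E) * w ((↑u⁻¹ : w.valuationSubring) : E) = 1 := by
      rw [← map_mul, ← MulMemClass.coe_mul, Units.mul_inv, OneMemClass.coe_one, map_one]
    by_contra hlt
    rw [not_le] at hlt
    have h2 : w ((↑u⁻¹ : w.valuationSubring) : E) ≤ 1 :=
      (Valuation.mem_valuationSubring_iff w _).mp (↑u⁻¹ : w.valuationSubring).2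
    exact (mul_lt_one_of_lt_of_le hlt h2).ne h1

/-- The restriction of the derivations to the valuation ring. -/
def valuationSubringPd (w : Valuation E Γ) (h : ∀ (i : Fin n) (f : E), w (pd i f) ≤ w f)
    (i : Fin n) : Derivation ℤ w.valuationSubring w.valuationSubring :=
  Derivation.mk' (AddMonoidHom.toIntLinearMap
    { toFun := fun x => ⟨pd i (x : E), (h i x).trans x.2⟩
      map_zero' := by ext; simp
      map_add' := fun x y => by ext; simp })
    (fun a b => by ext; simp)

theorem surjective_residueClass_toIntAlgHom (w : Valuation E Γ) :
    Function.Surjective (residueClass w).toIntAlgHom :=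
  IsLocalRing.residue_surjective

theorem residueClass_valuationSubringPd (w : Valuation E Γ)
    (h : ∀ (i : Fin n) (f : E), w (pd i f) ≤ w f) (i : Fin n) (x : w.valuationSubring)
    (hx : (residueClass w).toIntAlgHom x = 0) :
    (residueClass w).toIntAlgHom (valuationSubringPd w h i x) = 0 := by
  have hx : residueClass w x = 0 := hx
  change residueClass w _ = 0
  rw [residueClass_eq_zero_iff] at hx ⊢
  exact (h i x).trans_lt hx

/-- The derivations induced on the residue field by logarithmic derivations. -/
def residuePd (w : Valuation E Γ) (h : ∀ (i : Fin n) (f : E), w (pd i f) ≤ w f) (i : Fin n) :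
    Derivation ℤ (ValuationResidue w) (ValuationResidue w) :=
  Derivation.liftOfSurjective (surjective_residueClass_toIntAlgHom w)
    (d := valuationSubringPd w h i) (residueClass_valuationSubringPd w h i)

theorem residuePd_apply (w : Valuation E Γ) (h : ∀ (i : Fin n) (f : E), w (pd i f) ≤ w f)
    (i : Fin n) (x : w.valuationSubring) :
    residuePd w h i (residueClass w x) = residueClass w (valuationSubringPd w h i x) :=
  Derivation.liftOfSurjective_apply (surjective_residueClass_toIntAlgHom w)
    (residueClass_valuationSubringPd w h i) x

/-- Logarithmic derivations induce derivations of the residue field. -/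
@[reducible]
def residuePartialDiff (w : Valuation E Γ) (h : ∀ (i : Fin n) (f : E), w (pd i f) ≤ w f) :
    PartialDiff n (ValuationResidue w) where
  pd := residuePd w h
  pd_comm i j a := by
    obtain ⟨x, rfl⟩ := surjective_residueClass_toIntAlgHom w a
    change residuePd w h i (residuePd w h j (residueClass w x)) =
      residuePd w h j (residuePd w h i (residueClass w x))
    rw [residuePd_apply, residuePd_apply, residuePd_apply, residuePd_apply]
    congr 1
    ext
    exact PartialDiff.pd_comm i j (x : E)

theorem pd_residueClass (w : Valuation E Γ) (h : ∀ (i : Fin n) (f : E), w (pd i f) ≤ w f)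
    (i : Fin n) (x : w.valuationSubring) :
    letI := residuePartialDiff w h
    pd i (residueClass w x) = residueClass w ⟨pd i (x : E), (h i x).trans x.2⟩ :=
  residuePd_apply w h i x

/-- A nonzero vector has a nonzero entry of maximal valuation. -/
theorem exists_valuation_le {ι : Type*} [Finite ι] (w : Valuation E Γ) {a : ι → E} (ha : a ≠ 0) :
    ∃ j, a j ≠ 0 ∧ ∀ i, w (a i) ≤ w (a j) := by
  have : Nonempty ι := by
    by_contra h
    rw [not_nonempty_iff] at h
    exact ha (Subsingleton.elim _ _)
  obtain ⟨j, hj⟩ := Finite.exists_max fun i => w (a i)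
  refine ⟨j, fun h0 => ha ?_, hj⟩
  ext i
  have := hj i
  rw [h0, map_zero, le_zero_iff, Valuation.zero_iff] at this
  exact this

/-- Reduction of a pair with integral coefficients. -/
theorem IsIntegrablePair.residue {w : Valuation E Γ} (h : ∀ (i : Fin n) (f : E), w (pd i f) ≤ w f)
    {P ω α : Fin n → w.valuationSubring}
    (hp : IsIntegrablePair (fun i => (P i : E)) (fun i => (ω i : E)) (fun i => (α i : E)))
    (hω : ∃ i, w (ω i : E) = 1) :
    letI := residuePartialDiff w h
    IsIntegrablePair (fun i => residueClass w (P i)) (fun i => residueClass w (ω i))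
      (fun i => residueClass w (α i)) := by
  let := residuePartialDiff w h
  exact
  { ne_zero := fun h0 => by
      obtain ⟨i, hi⟩ := hω
      have h1 := congrFun h0 i
      simp only [Pi.zero_apply, residueClass_eq_zero_iff] at h1
      exact h1.ne hi
    sum_mul_eq_zero := by
      have h1 : ∑ i, ω i * P i = 0 := by
        ext
        push_cast
        exact hp.sum_mul_eq_zero
      simp only [← map_mul, ← map_sum, h1, map_zero]
    d_fst := fun i j => by
      rw [pd_residueClass, pd_residueClass, ← map_sub, ← map_mul, ← map_mul, ← map_sub]
      congr 1
      ext
      exact hp.d_fst i j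
    d_snd := fun i j => by
      rw [pd_residueClass, pd_residueClass]
      congr 1
      ext
      exact hp.d_snd i j }

/-- An integrable pair descends to the residue field of a valuation along which the derivations
are logarithmic. -/
theorem IsIntegrablePair.exists_residue {w : Valuation E Γ}
    (h : ∀ (i : Fin n) (f : E), w (pd i f) ≤ w f) {P : Fin n → w.valuationSubring}
    {ω α : Fin n → E} (hp : IsIntegrablePair (fun i => (P i : E)) ω α) :
    letI := residuePartialDiff w h
    ∃ ω' α' : Fin n → ValuationResidue w,
      IsIntegrablePair (fun i => residueClass w (P i)) ω' α' := by
  let := residuePartialDiff w h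
  have hlog : ∀ (i : Fin n) (u : E), u ≠ 0 → w (pd i u / u) ≤ 1 := by
    intro i u hu
    rw [map_div₀]
    exact div_le_one_of_le₀ (h i u) zero_le
  obtain ⟨j, hj0, hj⟩ := exists_valuation_le w hp.ne_zero
  have hwj : 0 < w (ω j) := zero_lt_iff.mpr ((Valuation.ne_zero_iff w).mpr hj0)
  have hq := hp.div hj0
  set ω₁ : Fin n → E := fun i => ω i / ω j with hω₁
  set α₁ : Fin n → E := fun i => α i - pd i (ω j) / ω j with hα₁
  have hω₁_le : ∀ i, w (ω₁ i) ≤ 1 := by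
    intro i
    rw [hω₁, map_div₀, div_le_one₀ hwj]
    exact hj i
  have hω₁_j : ω₁ j = 1 := div_self hj0
  -- The normalised ω₁ is integral with j-th coefficient 1. When α₁ has a pole, it supplies the
  -- reduced ω after division by its largest coefficient.
  by_cases hα : ∀ i, w (α₁ i) ≤ 1
  · exact ⟨_, _, IsIntegrablePair.residue h (ω := fun i => ⟨ω₁ i, hω₁_le i⟩)
      (α := fun i => ⟨α₁ i, hα i⟩) hq ⟨j, (congrArg w hω₁_j).trans w.map_one⟩⟩
  · push Not at hα
    obtain ⟨i₁, hi₁⟩ := hα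
    have hα₁0 : α₁ ≠ 0 := fun h0 => by simp [h0] at hi₁
    obtain ⟨k, hk0, hk⟩ := exists_valuation_le w hα₁0
    have hwk : 1 < w (α₁ k) := hi₁.trans_le (hk i₁)
    have hβ_le : ∀ i, w (α₁ i / α₁ k) ≤ 1 := by
      intro i
      rw [map_div₀, div_le_one₀ (zero_lt_one.trans hwk)]
      exact hk i
    have hγ_le : ∀ i : Fin n, w (-(pd i (α₁ k) / α₁ k)) ≤ 1 := by
      intro i
      rw [Valuation.map_neg]
      exact hlog i _ hk0
    let ω₂ : Fin n → w.valuationSubring := fun i => ⟨ω₁ i, hω₁_le i⟩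
    let β : Fin n → w.valuationSubring := fun i => ⟨α₁ i / α₁ k, hβ_le i⟩
    let γ : Fin n → w.valuationSubring := fun i => ⟨-(pd i (α₁ k) / α₁ k), hγ_le i⟩
    -- Dividing dω₁ = α₁ ∧ ω₁ by the pole α₁ k makes the left side vanish in the residue field, so β
    -- ∧ ω₂ = 0 there; the coefficient ω₂ j = 1 then determines the factor of proportionality.
    have hpar : ∀ i, residueClass w (β i) = residueClass w (β j) * residueClass w (ω₂ i) := by
      intro i
      have h1 : residueClass w (β i * ω₂ j - β j * ω₂ i) = 0 := by
        rw [residueClass_eq_zero_iff]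
        have h2 : ((β i * ω₂ j - β j * ω₂ i : w.valuationSubring) : E) =
            (pd i (ω₁ j) - pd j (ω₁ i)) / α₁ k := by
          rw [hq.d_fst]
          simp only [β, ω₂]
          push_cast
          ring
        rw [h2, map_div₀, div_lt_one₀ (zero_lt_one.trans hwk)]
        refine lt_of_le_of_lt ?_ hwk
        exact (w.map_sub _ _).trans
          (max_le ((h _ _).trans (hω₁_le j)) ((h _ _).trans (hω₁_le i)))
      have h3 : ω₂ j = 1 := Subtype.ext hω₁_j
      rwa [h3, mul_one, map_sub, sub_eq_zero, map_mul] at h1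
    -- The new pair is the reduction of (α₁/α₁ₖ, -dα₁ₖ/α₁ₖ), which is integrable because α₁ is
    -- closed.
    refine ⟨fun i => residueClass w (β i), fun i => residueClass w (γ i), ?_, ?_, ?_, ?_⟩
    · intro h0
      have h1 : residueClass w (β k) = 0 := congrFun h0 k
      rw [residueClass_eq_zero_iff] at h1
      simp only [β, div_self hk0, map_one, lt_irrefl] at h1
    · have h1 : ∑ i, ω₂ i * P i = 0 := by
        ext
        push_cast
        exact hq.sum_mul_eq_zero
      have h2 := congrArg (residueClass w) h1
      simp only [map_sum, map_mul, map_zero] at h2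
      have h3 : ∀ i, residueClass w (β i) * residueClass w (P i) =
          residueClass w (β j) * (residueClass w (ω₂ i) * residueClass w (P i)) := by
        intro i
        rw [hpar i, mul_assoc]
      rw [Finset.sum_congr rfl fun i _ => h3 i, ← Finset.mul_sum, h2, mul_zero]
    · intro i l
      rw [pd_residueClass, pd_residueClass, ← map_sub, ← map_mul, ← map_mul, ← map_sub]
      congr 1
      ext
      change pd i (α₁ l / α₁ k) - pd l (α₁ i / α₁ k) =
        -(pd i (α₁ k) / α₁ k) * (α₁ l / α₁ k) - -(pd l (α₁ k) / α₁ k) * (α₁ i / α₁ k)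
      rw [pd_div _ _ _ hk0, pd_div _ _ _ hk0, hq.d_snd i l]
      ring
    · intro i l
      rw [pd_residueClass, pd_residueClass]
      congr 1
      ext
      change pd i (-(pd l (α₁ k) / α₁ k)) = pd l (-(pd i (α₁ k) / α₁ k))
      rw [map_neg, map_neg, pd_logDeriv_comm i l _ hk0]

end Residue

/-- Some algebraic differential extension of `F` carries an integrable pair for `P`. -/
def HasAlgebraicPair.{u, v} {n : ℕ} {F : Type u} [Field F] [PartialDiff n F] (P : Fin n → F) :
    Prop :=
  ∃ (E : Type v) (_ : Field E) (_ : Algebra F E) (_ : PartialDiff n E),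
    IsDiffExtension n F E ∧ Algebra.IsAlgebraic F E ∧
    ∃ ω α : Fin n → E, IsIntegrablePair (fun i => algebraMap F E (P i)) ω α

/-- The residue field is the required extension: triviality of w on F embeds F in it, and `hres`
makes it algebraic over F. -/
theorem IsIntegrablePair.hasAlgebraicPair_of_valuation.{u, v} {n : ℕ} {F : Type u} {E : Type v}
    {Γ : Type*} [Field F]
    [Field E] [Algebra F E] [PartialDiff n F] [PartialDiff n E] [IsDiffExtension n F E]
    [LinearOrderedCommGroupWithZero Γ] (w : Valuation E Γ)
    (hF : ∀ a : F, a ≠ 0 → w (algebraMap F E a) = 1)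
    (h : ∀ (i : Fin n) (f : E), w (pd i f) ≤ w f)
    (hres : ∀ x, w x ≤ 1 → ∃ p : F[X], p ≠ 0 ∧ w (aeval x p) < 1)
    {P : Fin n → F} {ω α : Fin n → E}
    (hp : IsIntegrablePair (fun i => algebraMap F E (P i)) ω α) :
    HasAlgebraicPair.{u, v} P := by
  have hmem : ∀ a : F, algebraMap F E a ∈ w.valuationSubring := by
    intro a
    rw [Valuation.mem_valuationSubring_iff]
    rcases eq_or_ne a 0 with rfl | ha
    · simp
    · exact (hF a ha).le
  let f : F →+* w.valuationSubring := (algebraMap F E).codRestrict w.valuationSubring hmem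
  let : PartialDiff n (ValuationResidue w) := residuePartialDiff w h
  let : Algebra F w.valuationSubring := f.toAlgebra
  let : Algebra F (ValuationResidue w) := ((residueClass w).comp f).toAlgebra
  have : IsScalarTower F w.valuationSubring E := IsScalarTower.of_algebraMap_eq fun _ => rfl
  have : IsScalarTower F w.valuationSubring (ValuationResidue w) :=
    IsScalarTower.of_algebraMap_eq fun _ => rfl
  obtain ⟨ω', α', hp'⟩ := IsIntegrablePair.exists_residue h (P := fun i => f (P i)) hp
  refine ⟨ValuationResidue w, inferInstance, inferInstance, inferInstance, ⟨fun i a => ?_⟩,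
    ⟨fun x => ?_⟩, ω', α', hp'⟩
  · refine (pd_residueClass w h i (f a)).trans ?_
    change residueClass w _ = residueClass w (f (pd i a))
    congr 1
    ext
    exact IsDiffExtension.pd_algebraMap i a
  · obtain ⟨y, rfl⟩ := IsLocalRing.residue_surjective x
    obtain ⟨p, hp0, hpy⟩ := hres y y.2
    refine ⟨p, hp0, ?_⟩
    have h1 : aeval (residueClass w y) p = residueClass w (aeval y p) :=
      aeval_algebraMap_apply (ValuationResidue w) y p
    have h2 : ((aeval y p : w.valuationSubring) : E) = aeval (y : E) p :=
      (aeval_algebraMap_apply E y p).symm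
    refine h1.trans ?_
    rw [residueClass_eq_zero_iff, h2]
    exact hpy

/-! ### The place above t = 0 -/

section Place

variable {F E : Type*} [Field F] [Field E] [Algebra F E]

theorem mem_adjoin_singleton_iff {t a : E} :
    a ∈ Algebra.adjoin F {t} ↔ ∃ p : F[X], aeval t p = a := by
  rw [Algebra.adjoin_singleton_eq_range_aeval, AlgHom.mem_range]

theorem isPrincipalIdealRing_adjoin_singleton (t : E) :
    IsPrincipalIdealRing (Algebra.adjoin F {t}) := by
  refine IsPrincipalIdealRing.of_surjective
    (aeval (R := F) (⟨t, Algebra.self_mem_adjoin_singleton F t⟩ : Algebra.adjoin F {t})) ?_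
  rintro ⟨a, ha⟩
  obtain ⟨p, rfl⟩ := mem_adjoin_singleton_iff.mp ha
  refine ⟨p, Subtype.ext ?_⟩
  exact (aeval_algebraMap_apply E
    (⟨t, Algebra.self_mem_adjoin_singleton F t⟩ : Algebra.adjoin F {t}) p).symm

theorem inv_notMem_adjoin_singleton {t : E} (ht : Transcendental F t) :
    t⁻¹ ∉ Algebra.adjoin F {t} := by
  rw [mem_adjoin_singleton_iff]
  rintro ⟨p, hp⟩
  have ht0 : t ≠ 0 := fun h => ht (h ▸ isAlgebraic_zero)
  have h1 : aeval t (X * p - 1) = 0 := by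
    rw [map_sub, map_mul, aeval_X, hp, map_one, mul_inv_cancel₀ ht0, sub_self]
  have h2 := (transcendental_iff.mp ht) _ h1
  have h3 := congrArg (eval 0) h2
  simp at h3

/-- An element close to one that is integral over `F[t]` is algebraic over `F` modulo the maximal
ideal of a valuation ring that dominates `F[t]` at `t = 0`. -/
theorem exists_valuation_aeval_lt_one {Γ : Type*} [LinearOrderedCommGroupWithZero Γ]
    (w : Valuation E Γ) (hF : ∀ a : F, a ≠ 0 → w (algebraMap F E a) = 1) {t : E} (ht : w t < 1)
    {b x : E} (hb : IsIntegral (Algebra.adjoin F {t}) b) (hwb : w b ≤ 1) (hx : w (x - b) < 1) :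
    ∃ p : F[X], p ≠ 0 ∧ w (aeval x p) < 1 := by
  have hwx : w x ≤ 1 := by
    have : x = (x - b) + b := by ring
    rw [this]
    exact (w.map_add _ _).trans (max_le hx.le hwb)
  have hA : ∀ a : Algebra.adjoin F {t}, w (a : E) ≤ 1 := by
    rintro ⟨a, ha⟩
    obtain ⟨p, rfl⟩ := mem_adjoin_singleton_iff.mp ha
    exact valuation_aeval_le_one hF ht.le p
  have hc : ∀ a : Algebra.adjoin F {t}, ∃ c : F, w (algebraMap F E c - a) < 1 := by
    rintro ⟨a, ha⟩
    obtain ⟨p, rfl⟩ := mem_adjoin_singleton_iff.mp ha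
    -- Modulo t, a polynomial in t is its constant term.
    refine ⟨p.coeff 0, ?_⟩
    have h1 : algebraMap F E (p.coeff 0) - aeval t p = -(t * aeval t (divX p)) := by
      conv_lhs => rw [← divX_mul_X_add p]
      simp
      ring
    change w (algebraMap F E (p.coeff 0) - aeval t p) < 1
    rw [h1, Valuation.map_neg, map_mul]
    exact mul_lt_one_of_lt_of_le ht (valuation_aeval_le_one hF ht.le _)
  have hpow : ∀ k : ℕ, w (x ^ k - b ^ k) < 1 := by
    intro k
    induction k with
    | zero => simp
    | succ k ih =>
      have h1 : x ^ (k + 1) - b ^ (k + 1) = (x - b) * x ^ k + (x ^ k - b ^ k) * b := by ring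
      rw [h1]
      refine (w.map_add _ _).trans_lt (max_lt ?_ ?_)
      · rw [map_mul, map_pow]
        exact mul_lt_one_of_lt_of_le hx (pow_le_one' hwx k)
      · rw [map_mul]
        exact mul_lt_one_of_lt_of_le ih hwb
  obtain ⟨q, hq, hqb⟩ := hb
  choose c hc using hc
  -- The monic equation of b with its coefficients specialised at t = 0. It is nonzero because the
  -- leading coefficient 1 cannot specialise to 0.
  refine ⟨∑ k ∈ Finset.range (q.natDegree + 1), monomial k (c (q.coeff k)), fun h0 => ?_, ?_⟩
  · have h1 := congrArg (fun p => coeff p q.natDegree) h0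
    simp only [finsetSum_coeff, coeff_monomial, Finset.sum_ite_eq', Finset.mem_range,
      Nat.lt_succ_self, if_true, coeff_zero] at h1
    have h2 := hc (q.coeff q.natDegree)
    rw [h1, hq.coeff_natDegree] at h2
    simp at h2
  · have h1 : ∑ k ∈ Finset.range (q.natDegree + 1), ((q.coeff k : E) * b ^ k) = 0 := by
      rw [← hqb, eval₂_eq_sum_range]
      rfl
    have h2 : aeval x (∑ k ∈ Finset.range (q.natDegree + 1), monomial k (c (q.coeff k))) =
        ∑ k ∈ Finset.range (q.natDegree + 1),
          ((algebraMap F E (c (q.coeff k)) - q.coeff k) * x ^ k +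
            (q.coeff k : E) * (x ^ k - b ^ k)) := by
      rw [← sub_zero (aeval x _), ← h1, map_sum, ← Finset.sum_sub_distrib]
      refine Finset.sum_congr rfl fun k _ => ?_
      rw [aeval_monomial]
      ring
    rw [h2]
    refine w.map_sum_lt one_ne_zero fun k _ => (w.map_add _ _).trans_lt (max_lt ?_ ?_)
    · rw [map_mul, map_pow]
      exact mul_lt_one_of_lt_of_le (hc _) (pow_le_one' hwx k)
    · rw [map_mul, mul_comm]
      exact mul_lt_one_of_lt_of_le (hpow k) (hA _)

theorem exists_le_exp (y : ℤᵐ⁰) : ∃ N : ℕ, y ≤ WithZero.exp (N : ℤ) := by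
  rcases eq_or_ne y 0 with rfl | hy
  · exact ⟨0, zero_le⟩
  · refine ⟨(WithZero.log y).toNat, ?_⟩
    conv_lhs => rw [← WithZero.exp_log hy]
    rw [WithZero.exp_le_exp]
    exact Int.self_le_toNat _

/-- The place of a finite extension of `F(t)` above `t = 0`. -/
theorem exists_place [CharZero F] {t : E} (ht : Transcendental F t) [FiniteDimensional F⟮t⟯ E] :
    ∃ w : Valuation E ℤᵐ⁰, (∀ a : F, a ≠ 0 → w (algebraMap F E a) = 1) ∧
      (∃ a, w a = WithZero.exp (-1)) ∧ w t < 1 ∧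
      (∀ x, w x ≤ 1 → ∃ p : F[X], p ≠ 0 ∧ w (aeval x p) < 1) ∧
      ∀ D : Derivation ℤ E E, (∀ a ∈ Algebra.adjoin F {t}, D a ∈ Algebra.adjoin F {t}) →
        ∃ N : ℕ, ∀ x, w x ≤ 1 → w (D x) ≤ WithZero.exp (N : ℤ) := by
  classical
  open scoped algebraAdjoinAdjoin in
  let A := Algebra.adjoin F {t}
  let B := integralClosure A E
  have : CharZero F⟮t⟯ := charZero_of_injective_algebraMap (algebraMap F F⟮t⟯).injective
  have : IsPrincipalIdealRing A := isPrincipalIdealRing_adjoin_singleton t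
  have : IsScalarTower A F⟮t⟯ E := inferInstance
  have : IsFractionRing A F⟮t⟯ := inferInstance
  have : IsDedekindDomain B := integralClosure.isDedekindDomain A F⟮t⟯ E
  have : IsFractionRing B E := integralClosure.isFractionRing_of_finite_extension F⟮t⟯ E
  have : Module.Finite A B := IsIntegralClosure.finite A F⟮t⟯ E B
  have ht0 : t ≠ 0 := fun h => ht (h ▸ isAlgebraic_zero)
  let tA : A := ⟨t, Algebra.self_mem_adjoin_singleton F t⟩
  let tB : B := algebraMap A B tA
  have htB : (tB : E) = t := rfl
  -- If 1/t were integral over F[t], it would lie in F[t], which is integrally closed. Hence some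
  -- maximal ideal of B contains t, and it gives the place.
  have htu : ¬ IsUnit tB := by
    intro hu
    obtain ⟨s, hs⟩ := hu.exists_right_inv
    have hs' : (s : E) = t⁻¹ := by
      refine eq_inv_of_mul_eq_one_right ?_
      exact congrArg Subtype.val hs
    have hint : IsIntegral A t⁻¹ := hs' ▸ s.2
    have hmem : t⁻¹ ∈ F⟮t⟯ := inv_mem (mem_adjoin_simple_self F t)
    have hint' : IsIntegral A (⟨t⁻¹, hmem⟩ : F⟮t⟯) :=
      (isIntegral_algebraMap_iff (algebraMap F⟮t⟯ E).injective).mp hint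
    obtain ⟨y, hy⟩ := IsIntegrallyClosed.isIntegral_iff.mp hint'
    have hy' : (y : E) = t⁻¹ := congrArg Subtype.val hy
    exact inv_notMem_adjoin_singleton ht (hy' ▸ y.2)
  obtain ⟨m, hm, htm⟩ := exists_max_ideal_of_mem_nonunits htu
  let v : IsDedekindDomain.HeightOneSpectrum B := ⟨m, hm.isPrime, fun h0 => by
    rw [h0, Ideal.mem_bot] at htm
    exact ht0 (htB ▸ congrArg Subtype.val htm)⟩
  let w := v.valuation E
  have hB : ∀ b : B, w (b : E) ≤ 1 := v.valuation_le_one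
  have hA : ∀ a ∈ A, w a ≤ 1 := fun a ha => hB (algebraMap A B ⟨a, ha⟩)
  have hF1 : ∀ a : F, w (algebraMap F E a) ≤ 1 := fun a => hA _ (A.algebraMap_mem a)
  have hF : ∀ a : F, a ≠ 0 → w (algebraMap F E a) = 1 := by
    intro a ha
    refine le_antisymm (hF1 a) ?_
    have h1 := hF1 a⁻¹
    rw [map_inv₀, map_inv₀] at h1
    have h2 : w (algebraMap F E a) ≠ 0 :=
      (Valuation.ne_zero_iff w).mpr ((map_ne_zero (algebraMap F E)).mpr ha)
    exact (inv_le_one₀ (zero_lt_iff.mpr h2)).mp h1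
  have hwt : w t < 1 := (v.valuation_lt_one_iff_mem (K := E) tB).mpr htm
  refine ⟨w, hF, v.valuation_exists_uniformizer E, hwt, fun x hx => ?_, fun D hD => ?_⟩
  · obtain ⟨b, hb⟩ := v.exists_valuation_sub_lt_of_integer hx 1
    rw [Valuation.map_sub_swap] at hb
    exact exists_valuation_aeval_lt_one w hF hwt (b := (b : E)) b.2 (hB b) hb
  -- B is a finite F[t]-module and D preserves F[t], so the values of D on finitely many generators
  -- bound its poles on all of B.
  · obtain ⟨s, hs⟩ := Module.Finite.fg_top (R := A) (M := B)
    choose N hN using fun b : B => exists_le_exp (w (D (b : E)))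
    have hbound : ∀ b : B, w (D (b : E)) ≤ WithZero.exp ((s.sup N : ℕ) : ℤ) := by
      intro b
      have hb : b ∈ Submodule.span A (s : Set B) := hs ▸ Submodule.mem_top
      induction hb using Submodule.span_induction with
      | mem b hb =>
        refine (hN b).trans ?_
        rw [WithZero.exp_le_exp]
        exact_mod_cast Finset.le_sup (f := N) hb
      | zero => simp
      | add b c _ _ hb hc =>
        rw [Subalgebra.coe_add, map_add]
        exact (w.map_add _ _).trans (max_le hb hc)
      | smul a b _ hb =>
        have h1 : ((a • b : B) : E) = (a : E) * b := rfl
        rw [h1, Derivation.leibniz]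
        refine (w.map_add _ _).trans (max_le ?_ ?_)
        · rw [smul_eq_mul, map_mul]
          exact (mul_le_of_le_one_left' (hA a a.2)).trans hb
        · rw [smul_eq_mul, map_mul]
          refine (mul_le_one' (hB b) (hA _ (hD a a.2))).trans ?_
          rw [← WithZero.exp_zero, WithZero.exp_le_exp]
          positivity
    refine ⟨s.sup N, fun x hx => ?_⟩
    -- An integral x is b/c with c a unit at the place, so the quotient rule carries the bound from
    -- B to the valuation ring.
    obtain ⟨b, ⟨c, hc⟩, hbc⟩ := v.exists_primeCompl_mul_eq_of_integer x hx
    have hbc : x * (c : E) = (b : E) := hbc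
    have hwc : w (c : E) = 1 := v.valuation_eq_one_iff_notMem.mpr hc
    have h1 : D x * c = D (b : E) - x * D (c : E) := by
      rw [← hbc, Derivation.leibniz, smul_eq_mul, smul_eq_mul]
      ring
    have h2 : w (D x) = w (D x * c) := by rw [map_mul, hwc, mul_one]
    rw [h2, h1]
    refine (w.map_sub _ _).trans (max_le (hbound b) ?_)
    rw [map_mul]
    exact (mul_le_of_le_one_left' hx).trans (hbound c)

end Place

/-! ### Descent through one generator -/

section Step

universe u v

variable {n : ℕ} {F : Type u} {E : Type v} [Field F] [Field E] [Algebra F E] [CharZero F]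
  [PartialDiff n F] [PartialDiff n E] [IsDiffExtension n F E]

/-- The relation ∂t = t·q(t) keeps F[t] stable and makes ∂t/t integral at t = 0. These are the two
inputs needed for the derivations to be logarithmic at the place. -/
theorem hasAlgebraicPair_of_finiteDimensional {t : E} (ht : Transcendental F t)
    [FiniteDimensional F⟮t⟯ E] (hdt : ∀ i : Fin n, ∃ q : F[X], pd i t = t * aeval t q)
    {P : Fin n → F} {ω α : Fin n → E}
    (hp : IsIntegrablePair (fun i => algebraMap F E (P i)) ω α) : HasAlgebraicPair.{u, v} P := by
  obtain ⟨w, hF, ⟨a, ha⟩, hwt, hres, hbound⟩ := exists_place ht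
  refine hp.hasAlgebraicPair_of_valuation w hF (fun i f => ?_) hres
  obtain ⟨q, hq⟩ := hdt i
  obtain ⟨N, hN⟩ := hbound (pd i) (by
    intro a ha
    obtain ⟨p, rfl⟩ := mem_adjoin_singleton_iff.mp ha
    rw [derivation_aeval (IsDiffExtension.pd_algebraMap (K := F) (L := E) i), hq,
      mem_adjoin_singleton_iff]
    exact ⟨coeffDeriv (pd i) p + derivative p * (X * q), by simp⟩)
  refine valuation_derivation_le w hF ha (fun h : t = 0 => ht (h ▸ isAlgebraic_zero)) hwt hres
    (IsDiffExtension.pd_algebraMap i) ?_ N hN f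
  rw [hq, map_mul]
  exact mul_le_of_le_one_right' (valuation_aeval_le_one hF hwt.le q)

theorem finiteDimensional_adjoin_of_isAlgebraic {F E : Type*} [Field F] [Field E] [Algebra F E]
    {T : Set E} (hT : T.Finite) (t : adjoin F T)
    (h : ∀ x ∈ adjoin F T, IsAlgebraic F⟮(t : E)⟯ x) :
    FiniteDimensional F⟮t⟯ (adjoin F T) := by
  have h1 : Algebra.IsAlgebraic F⟮t⟯ (adjoin F T) := by
    refine ⟨fun x => ?_⟩
    have hl : lift F⟮t⟯ = F⟮(t : E)⟯ := lift_adjoin_simple F (adjoin F T) t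
    let e : F⟮t⟯ ≃ₐ[F] F⟮(t : E)⟯ := (liftAlgEquiv F⟮t⟯).trans (equivOfEq hl)
    exact (h x x.2).of_ringHom_of_comp_eq (e : F⟮t⟯ →+* F⟮(t : E)⟯) (algebraMap (adjoin F T) E)
      e.surjective (algebraMap (adjoin F T) E).injective rfl
  have h2 : Algebra.EssFiniteType F (adjoin F T) :=
    essFiniteType_iff.mpr (fg_adjoin_of_finite hT)
  have h3 : Algebra.EssFiniteType F⟮t⟯ (adjoin F T) := Algebra.EssFiniteType.of_comp F _ _
  exact Algebra.finite_of_essFiniteType_of_isAlgebraic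

/-- E may be infinite over F(t). The argument takes place in the subfield generated by t and the
finitely many coefficients, which is finite over F(t) and stable under the derivations. -/
theorem hasAlgebraicPair_of_transcendental {t : E} (ht : Transcendental F t)
    (halg : ∀ x : E, IsAlgebraic F⟮t⟯ x)
    (hdt : ∀ i : Fin n, ∃ q : F[X], pd i t = t * aeval t q)
    {P : Fin n → F} {ω α : Fin n → E}
    (hp : IsIntegrablePair (fun i => algebraMap F E (P i)) ω α) : HasAlgebraicPair.{u, v} P := by
  let T : Set E := {t} ∪ (Set.range ω ∪ Set.range α)
  have hT : T.Finite :=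
    (Set.finite_singleton t).union ((Set.finite_range ω).union (Set.finite_range α))
  have hG : ∀ (i : Fin n), ∀ x ∈ F⟮t⟯, pd i x ∈ F⟮t⟯ := by
    refine fun i x hx => pd_mem_adjoin (fun i x hx => ?_) i hx
    rw [Set.mem_singleton_iff] at hx
    obtain ⟨q, hq⟩ := hdt i
    rw [hx, hq]
    exact mul_mem (mem_adjoin_simple_self F t) (algebra_adjoin_le_adjoin F {t}
      (mem_adjoin_singleton_iff.mpr ⟨q, rfl⟩))
  have hGT : F⟮t⟯ ≤ adjoin F T := adjoin.mono F _ _ Set.subset_union_left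
  have hH : ∀ (i : Fin n), ∀ x ∈ adjoin F T, pd i x ∈ adjoin F T :=
    fun i x hx => pd_mem_adjoin_of_isAlgebraic hGT hG (fun x _ => halg x) i hx
  let := PartialDiff.restrict (adjoin F T) hH
  have := isDiffExtension_base_restrict (adjoin F T) hH
  have hmem : ∀ x ∈ T, x ∈ adjoin F T := fun x hx => subset_adjoin F T hx
  let t' : adjoin F T := ⟨t, hmem t (Or.inl rfl)⟩
  have := finiteDimensional_adjoin_of_isAlgebraic hT t' (fun x _ => halg x)
  refine hasAlgebraicPair_of_finiteDimensional (E := adjoin F T) (t := t') ?_ (fun i => ?_)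
    (ω := fun i => ⟨ω i, hmem _ (Or.inr (Or.inl ⟨i, rfl⟩))⟩)
    (α := fun i => ⟨α i, hmem _ (Or.inr (Or.inr ⟨i, rfl⟩))⟩)
    (IsIntegrablePair.of_map (algebraMap (adjoin F T) E) (fun _ _ => rfl) hp)
  · rwa [← transcendental_algebraMap_iff (algebraMap (adjoin F T) E).injective]
  · obtain ⟨q, hq⟩ := hdt i
    refine ⟨q, Subtype.ext ?_⟩
    have h1 : ((aeval t' q : adjoin F T) : E) = aeval t q := (aeval_algebraMap_apply E t' q).symm
    change pd i t = t * ((aeval t' q : adjoin F T) : E)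
    rw [h1, hq]

/-- Descent of integrable pairs along one step of a Liouvillian tower. -/
theorem hasAlgebraicPair_of_liouvillian {t : E} (halg : ∀ x : E, IsAlgebraic F⟮t⟯ x)
    (hstep : (t ≠ 0 ∧ ∀ i : Fin n, ∃ a : F, pd i t / t = algebraMap F E a) ∨
      (∀ i : Fin n, ∃ a : F, pd i t = algebraMap F E a) ∨ IsAlgebraic F t)
    {P : Fin n → F} {ω α : Fin n → E}
    (hp : IsIntegrablePair (fun i => algebraMap F E (P i)) ω α) : HasAlgebraicPair.{u, v} P := by
  by_cases ht : IsAlgebraic F t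
  · have h1 : Algebra.IsAlgebraic F F⟮t⟯ := isAlgebraic_adjoin_simple ht.isIntegral
    have h2 : Algebra.IsAlgebraic F⟮t⟯ E := ⟨halg⟩
    exact ⟨E, inferInstance, inferInstance, inferInstance, inferInstance,
      Algebra.IsAlgebraic.trans F F⟮t⟯ E, ω, α, hp⟩
  · have ht0 : t ≠ 0 := fun h => ht (h ▸ isAlgebraic_zero)
    rcases hstep with ⟨-, hstep⟩ | hstep | hstep
    · refine hasAlgebraicPair_of_transcendental ht halg (fun i => ?_) hp
      obtain ⟨a, ha⟩ := hstep i
      refine ⟨C a, ?_⟩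
      rw [aeval_C, ← ha]
      field_simp
    -- An integral is specialised at t = ∞: with s = 1/t and ∂t = a, one has ∂s = s·(-a s), whereas
    -- ∂t need not vanish at t = 0.
    · have hinv : Transcendental F t⁻¹ := fun h => ht (inv_inv t ▸ h.inv)
      have hle : F⟮t⟯ ≤ F⟮t⁻¹⟯ := by
        rw [adjoin_simple_le_iff]
        have := inv_mem (mem_adjoin_simple_self F t⁻¹)
        rwa [inv_inv] at this
      refine hasAlgebraicPair_of_transcendental hinv (fun x => ?_) (fun i => ?_) hp
      · exact (halg x).ringHom_of_comp_eq (inclusion hle : F⟮t⟯ →+* F⟮t⁻¹⟯) (RingHom.id E)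
          (inclusion hle).injective rfl
      · obtain ⟨a, ha⟩ := hstep i
        refine ⟨-(X * C a), ?_⟩
        rw [Derivation.leibniz_inv, ha]
        simp
        ring
    · exact absurd hstep ht

end Step

/-! ### Descent along the whole tower -/

section Tower

universe u v

variable {n : ℕ} {K : Type u} {L : Type v} [Field K] [Field L] [Algebra K L] [CharZero K]
  [PartialDiff n K] [PartialDiff n L]

/-- `HasAlgebraicPair` over a differential intermediate field. -/
def HasAlgebraicPairOver (P : Fin n → K) (G : IntermediateField K L)
    (hG : ∀ (i : Fin n), ∀ x ∈ G, pd i x ∈ G) : Prop :=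
  letI := PartialDiff.restrict G hG
  HasAlgebraicPair.{v, v} (fun i => algebraMap K G (P i))

theorem IsLiouvillianStep.pd_mem [IsDiffExtension n K L] {G G' : IntermediateField K L}
    (h : IsLiouvillianStep n K L G G') (hG : ∀ (i : Fin n), ∀ x ∈ G, pd i x ∈ G) (i : Fin n)
    (x : L) (hx : x ∈ G') : pd i x ∈ G' := by
  obtain ⟨t, rfl, ht⟩ := h
  let := PartialDiff.restrict G hG
  have := isDiffExtension_restrict G hG
  have : CharZero G := charZero_of_injective_algebraMap (algebraMap K G).injective
  have htm : t ∈ adjoin G {t} := mem_adjoin_simple_self G t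
  refine pd_mem_adjoin (F := G) (T := {t}) (fun i x hx => ?_) i hx
  rw [Set.mem_singleton_iff] at hx
  subst hx
  rcases ht with ⟨h0, ht⟩ | ht | ht
  · have h1 : pd i x = pd i x / x * x := by field_simp
    rw [h1]
    exact mul_mem (IntermediateField.algebraMap_mem (adjoin G {x}) ⟨_, ht i⟩) htm
  · exact IntermediateField.algebraMap_mem (adjoin G {x}) ⟨_, ht i⟩
  · refine pd_mem_of_isAlgebraic (F := G) (G := ⊥) bot_le pd_mem_bot ?_ htm i
    exact ht.ringHom_of_comp_eq (algebraMap G (⊥ : IntermediateField G L)) (RingHom.id L)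
      (algebraMap G (⊥ : IntermediateField G L)).injective rfl

/-- The extension E carrying the pair is algebraic over G' = G(t), hence over G(t') with t' the
image of t in E. So the descent through one generator applies to E itself. -/
theorem IsLiouvillianStep.hasAlgebraicPairOver [IsDiffExtension n K L]
    {G G' : IntermediateField K L}
    (h : IsLiouvillianStep n K L G G') (hG : ∀ (i : Fin n), ∀ x ∈ G, pd i x ∈ G)
    (hG' : ∀ (i : Fin n), ∀ x ∈ G', pd i x ∈ G') {P : Fin n → K}
    (hP : HasAlgebraicPairOver P G' hG') : HasAlgebraicPairOver P G hG := by
  obtain ⟨t, hGG', ht⟩ := h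
  let := PartialDiff.restrict G hG
  let := PartialDiff.restrict G' hG'
  have : CharZero G := charZero_of_injective_algebraMap (algebraMap K G).injective
  have hle : G ≤ G' := by
    rw [hGG']
    exact fun x hx => IntermediateField.algebraMap_mem (adjoin G {t}) ⟨x, hx⟩
  have htG' : t ∈ G' := by
    rw [hGG']
    exact mem_adjoin_simple_self G t
  obtain ⟨E, _, _, _, _, _, ω, α, hp⟩ := hP
  let : Algebra G E := ((algebraMap G' E).comp (inclusion hle : G →+* G')).toAlgebra
  have : IsDiffExtension n G E :=
    ⟨fun i a => IsDiffExtension.pd_algebraMap (K := G') i (inclusion hle a)⟩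
  let t' : E := algebraMap G' E ⟨t, htG'⟩
  have hmem : ∀ y : G', algebraMap G' E y ∈ G⟮t'⟯ := by
    rintro ⟨y, hy⟩
    have hy' : y ∈ adjoin G {t} := by
      rw [hGG'] at hy
      exact hy
    have hle' : ∀ z ∈ adjoin G {t}, z ∈ G' := by
      intro z hz
      rw [hGG']
      exact hz
    induction hy' using adjoin_induction with
    | mem x hx =>
      rw [Set.mem_singleton_iff] at hx
      subst hx
      exact mem_adjoin_simple_self G t'
    | algebraMap a => exact IntermediateField.algebraMap_mem G⟮t'⟯ a
    | add x y hx hy' ihx ihy =>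
      exact (map_add (algebraMap G' E) ⟨x, hle' x hx⟩ ⟨y, hle' y hy'⟩) ▸
        add_mem (ihx (hle' x hx)) (ihy (hle' y hy'))
    | inv x hx ihx =>
      exact (map_inv₀ (algebraMap G' E) ⟨x, hle' x hx⟩) ▸ inv_mem (ihx (hle' x hx))
    | mul x y hx hy' ihx ihy =>
      exact (map_mul (algebraMap G' E) ⟨x, hle' x hx⟩ ⟨y, hle' y hy'⟩) ▸
        mul_mem (ihx (hle' x hx)) (ihy (hle' y hy'))
  have halg : ∀ x : E, IsAlgebraic G⟮t'⟯ x := fun x =>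
    (Algebra.IsAlgebraic.isAlgebraic (R := G') x).ringHom_of_comp_eq
      ((algebraMap G' E).codRestrict G⟮t'⟯ hmem) (RingHom.id E) (RingHom.injective _) rfl
  refine hasAlgebraicPair_of_liouvillian halg ?_ hp
  have hpd : ∀ i : Fin n, pd i t' = algebraMap G' E ⟨pd i t, hG' i t htG'⟩ :=
    fun i => IsDiffExtension.pd_algebraMap (K := G') (L := E) i ⟨t, htG'⟩
  rcases ht with ⟨h0, ht⟩ | ht | ht
  · refine Or.inl ⟨fun h => h0 ?_, fun i => ⟨⟨_, ht i⟩, ?_⟩⟩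
    · have h1 := (map_eq_zero (algebraMap G' E)).mp h
      exact congrArg Subtype.val h1
    · rw [hpd, ← map_div₀]
      rfl
  · exact Or.inr (Or.inl fun i => ⟨⟨_, ht i⟩, hpd i⟩)
  · refine Or.inr (Or.inr ?_)
    let : Algebra G G' := (inclusion hle : G →+* G').toAlgebra
    have h1 : IsAlgebraic G (⟨t, htG'⟩ : G') :=
      ht.of_ringHom_of_comp_eq (RingHom.id G) (algebraMap G' L) Function.surjective_id
        (algebraMap G' L).injective rfl
    exact h1.ringHom_of_comp_eq (RingHom.id G) (algebraMap G' E) Function.injective_id rfl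

theorem IsLiouvillianExtension.hasAlgebraicPair (hL : IsLiouvillianExtension n K L)
    {P : Fin n → K} {ω α : Fin n → L}
    (hp : IsIntegrablePair (fun i => algebraMap K L (P i)) ω α) : HasAlgebraicPair.{u, v} P := by
  have := hL.isDiffExtension
  obtain ⟨m, T, hT0, hTm, hT⟩ := hL.exists_tower
  have hpd : ∀ k ≤ m, ∀ (i : Fin n), ∀ x ∈ T k, pd i x ∈ T k := by
    intro k
    induction k with
    | zero =>
      intro _
      rw [hT0]
      exact pd_mem_bot
    | succ k ih =>
      intro hk
      exact (hT k (by omega)).pd_mem (ih (by omega))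
  have htop : HasAlgebraicPairOver P (T m) (hpd m le_rfl) := by
    let := PartialDiff.restrict (T m) (hpd m le_rfl)
    refine ⟨L, inferInstance, inferInstance, inferInstance,
      isDiffExtension_restrict (T m) (hpd m le_rfl), ⟨fun x => ?_⟩, ω, α, hp⟩
    have hx : x ∈ T m := by
      rw [hTm]
      exact mem_top
    exact isAlgebraic_algebraMap (⟨x, hx⟩ : T m)
  have hdesc : ∀ k, (hk : k ≤ m) → HasAlgebraicPairOver P (T k) (hpd k hk) := by
    intro k hk
    induction hk using Nat.decreasingInduction with
    | self => exact htop
    | of_succ k hk ih => exact (hT k hk).hasAlgebraicPairOver _ _ ih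
  have hzero := hdesc 0 (Nat.zero_le m)
  let := PartialDiff.restrict (T 0) (hpd 0 (Nat.zero_le m))
  have := isDiffExtension_base_restrict (T 0) (hpd 0 (Nat.zero_le m))
  obtain ⟨E, _, _, _, _, _, ω', α', hp'⟩ := hzero
  let : Algebra K E := ((algebraMap (T 0) E).comp (algebraMap K (T 0))).toAlgebra
  have : IsScalarTower K (T 0) E := IsScalarTower.of_algebraMap_eq fun _ => rfl
  have : Algebra.IsAlgebraic K (T 0) := by
    rw [hT0]
    infer_instance
  exact ⟨E, inferInstance, inferInstance, inferInstance, IsDiffExtension.trans (E := T 0),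
    Algebra.IsAlgebraic.trans K (T 0) E, ω', α', hp'⟩

end Tower

/-! ### Passage to a finite extension -/

section Small

/-- Transport of the derivations along an isomorphism of fields. -/
@[reducible]
def PartialDiff.ofRingEquiv {n : ℕ} {E E' : Type*} [Field E] [Field E'] [PartialDiff n E]
    (e : E' ≃+* E) : PartialDiff n E' where
  pd i := Derivation.mk' (AddMonoidHom.toIntLinearMap
    { toFun := fun x => e.symm (pd i (e x))
      map_zero' := by simp
      map_add' := fun x y => by simp })
    (fun a b => by simp)
  pd_comm i j a := by
    change e.symm (pd i (e (e.symm (pd j (e a))))) = e.symm (pd j (e (e.symm (pd i (e a)))))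
    rw [e.apply_symm_apply, e.apply_symm_apply, PartialDiff.pd_comm]

/-- The field carrying an integrable pair may be taken finite over the base, in the universe of the
base. -/
theorem HasAlgebraicPair.exists_finiteDimensional.{u, v} {n : ℕ} {F : Type u} [Field F]
    [CharZero F] [PartialDiff n F] {P : Fin n → F} (h : HasAlgebraicPair.{u, v} P) :
    ∃ (E : Type u) (_ : Field E) (_ : Algebra F E) (_ : PartialDiff n E),
      IsDiffExtension n F E ∧ FiniteDimensional F E ∧
      ∃ ω α : Fin n → E, IsIntegrablePair (fun i => algebraMap F E (P i)) ω α := by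
  obtain ⟨E, _, _, _, _, _, ω, α, hp⟩ := h
  let T : Set E := Set.range ω ∪ Set.range α
  have hT : T.Finite := (Set.finite_range ω).union (Set.finite_range α)
  have hH : ∀ (i : Fin n), ∀ x ∈ adjoin F T, pd i x ∈ adjoin F T := fun i x hx =>
    pd_mem_adjoin_of_isAlgebraic bot_le pd_mem_bot
      (fun x _ => (Algebra.IsAlgebraic.isAlgebraic (R := F) x).tower_top _) i hx
  let H := adjoin F T
  let := PartialDiff.restrict H hH
  have := isDiffExtension_base_restrict H hH
  have : FiniteDimensional F H := by
    have : Finite T := hT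
    exact finiteDimensional_adjoin fun x _ => Algebra.IsIntegral.isIntegral x
  -- Embedding the finite extension in the algebraic closure of F brings it into the universe of F.
  let f : H →ₐ[F] AlgebraicClosure F := IsAlgClosed.lift
  let e : H ≃ₐ[F] f.fieldRange := AlgEquiv.ofInjectiveField f
  let := PartialDiff.ofRingEquiv (n := n) e.symm.toRingEquiv
  have hpde : ∀ (i : Fin n) (a : H), pd i (e a) = e (pd i a) := by
    intro i a
    change e (pd i (e.symm (e a))) = _
    rw [e.symm_apply_apply]
  refine ⟨f.fieldRange, inferInstance, inferInstance, inferInstance, ⟨fun i a => ?_⟩,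
    e.toLinearEquiv.finiteDimensional, ?_⟩
  · rw [← e.commutes, hpde, IsDiffExtension.pd_algebraMap, e.commutes]
  · have hmem : ∀ x ∈ T, x ∈ H := fun x hx => subset_adjoin F T hx
    have hpH : IsIntegrablePair (fun i => algebraMap F H (P i))
        (fun i => ⟨ω i, hmem _ (Or.inl ⟨i, rfl⟩)⟩) (fun i => ⟨α i, hmem _ (Or.inr ⟨i, rfl⟩)⟩) :=
      IsIntegrablePair.of_map (algebraMap H E) (fun _ _ => rfl) hp
    have hpe := hpH.map (e : H →+* f.fieldRange) hpde
    have hP : (fun i => algebraMap F f.fieldRange (P i)) =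
        (e : H →+* f.fieldRange) ∘ fun i => algebraMap F H (P i) :=
      funext fun i => (e.commutes (P i)).symm
    rw [hP]
    exact ⟨_, _, hpe⟩

end Small

/-! ### Constants of the rational function field -/

section RationalConstants

theorem totalDegree_pderiv_lt {σ R : Type*} [CommRing R] {q : MvPolynomial σ R} {i : σ}
    (h : MvPolynomial.pderiv i q ≠ 0) :
    (MvPolynomial.pderiv i q).totalDegree < q.totalDegree := by
  classical
  rw [MvPolynomial.totalDegree, Finset.sup_lt_iff]
  · intro m hm
    rw [MvPolynomial.mem_support_iff, MvPolynomial.coeff_pderiv] at hm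
    have h1 : m + Finsupp.single i 1 ∈ q.support :=
      MvPolynomial.mem_support_iff.mpr (left_ne_zero_of_mul hm)
    have h2 := MvPolynomial.le_totalDegree h1
    rw [Finsupp.sum_add_index' (by simp) (by simp), Finsupp.sum_single_index rfl] at h2
    exact h2
  · obtain ⟨m, hm⟩ := MvPolynomial.ne_zero_iff.mp h
    rw [MvPolynomial.coeff_pderiv] at hm
    have h1 : m + Finsupp.single i 1 ∈ q.support :=
      MvPolynomial.mem_support_iff.mpr (left_ne_zero_of_mul hm)
    have h2 := MvPolynomial.le_totalDegree h1
    rw [Finsupp.sum_add_index' (by simp) (by simp), Finsupp.sum_single_index rfl] at h2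
    rw [Nat.bot_eq_zero]
    omega

/-- A nonzero partial derivative has smaller total degree than q, so it is not a multiple of q. -/
theorem pderiv_eq_zero_of_dvd {σ R : Type*} [CommRing R] [IsDomain R] {q : MvPolynomial σ R}
    {i : σ} (h : q ∣ MvPolynomial.pderiv i q) : MvPolynomial.pderiv i q = 0 := by
  by_contra h0
  obtain ⟨r, hr⟩ := h
  have h1 := totalDegree_pderiv_lt h0
  rw [hr] at h0
  rw [hr, MvPolynomial.totalDegree_mul_of_isDomain (left_ne_zero_of_mul h0)
    (right_ne_zero_of_mul h0)] at h1
  omega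

theorem exists_eq_C_of_pderiv_eq_zero {σ R : Type*} [CommRing R] [IsDomain R] [CharZero R]
    {q : MvPolynomial σ R} (h : ∀ i, MvPolynomial.pderiv i q = 0) :
    ∃ c, q = MvPolynomial.C c := by
  refine ⟨q.coeff 0, ?_⟩
  classical
  ext m
  rw [MvPolynomial.coeff_C]
  split_ifs with hm
  · rw [hm]
  · obtain ⟨i, hi⟩ : ∃ i, m i ≠ 0 := by
      by_contra hc
      push Not at hc
      exact hm (Finsupp.ext hc).symm
    have h1 := congrArg (MvPolynomial.coeff (m - Finsupp.single i 1)) (h i)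
    have h2 : m - Finsupp.single i 1 + Finsupp.single i 1 = m :=
      tsub_add_cancel_of_le (Finsupp.single_le_iff.mpr (Nat.one_le_iff_ne_zero.mpr hi))
    rw [MvPolynomial.coeff_pderiv, h2, MvPolynomial.coeff_zero] at h1
    exact (mul_eq_zero.mp h1).resolve_right (Nat.cast_add_one_ne_zero _)

theorem derivation_mul_eq_of_div_eq_zero {A K : Type*} [CommRing A] [Field K] [Algebra A K]
    [FaithfulSMul A K] {d : A → A} {D : Derivation ℤ K K}
    (hd : ∀ a, D (algebraMap A K a) = algebraMap A K (d a)) {a b : A} (hb : b ≠ 0)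
    (h : D (algebraMap A K a / algebraMap A K b) = 0) : d a * b = a * d b := by
  have hinj := FaithfulSMul.algebraMap_injective A K
  have hb' : algebraMap A K b ≠ 0 := fun h => hb (hinj (by rw [h, map_zero]))
  rw [Derivation.leibniz_div, hd, hd] at h
  simp only [smul_eq_mul] at h
  have h2 := (mul_eq_zero.mp h).resolve_left (pow_ne_zero 2 (inv_ne_zero hb'))
  apply hinj
  rw [map_mul, map_mul]
  linear_combination h2

/-- For a reduced fraction a/b the condition reads ∂a·b = a·∂b, so b divides ∂b. Hence ∂b = 0, then
∂a = 0, for every partial derivative. -/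
theorem exists_complex_of_fracPd_eq_zero {n : ℕ} (K : Type*) [Field K]
    [Algebra (MvPolynomial (Fin n) ℂ) K] [IsFractionRing (MvPolynomial (Fin n) ℂ) K] {c : K}
    (hc : ∀ i : Fin n, fracPd K i c = 0) :
    c ∈ ((algebraMap (MvPolynomial (Fin n) ℂ) K).comp MvPolynomial.C).range := by
  obtain ⟨a, ⟨b, hb⟩, hab, rfl⟩ :=
    IsFractionRing.exists_reduced_fraction (A := MvPolynomial (Fin n) ℂ) c
  have hb0 : b ≠ 0 := nonZeroDivisors.ne_zero hb
  rw [IsFractionRing.mk'_eq_div] at hc ⊢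
  have key : ∀ i : Fin n, MvPolynomial.pderiv i a * b = a * MvPolynomial.pderiv i b := fun i =>
    derivation_mul_eq_of_div_eq_zero (fracPd_algebraMap K i) hb0 (hc i)
  have hb1 : ∀ i, MvPolynomial.pderiv i b = 0 := fun i =>
    pderiv_eq_zero_of_dvd (hab.symm.dvd_of_dvd_mul_left ⟨_, (key i).symm.trans (mul_comm _ _)⟩)
  have ha1 : ∀ i, MvPolynomial.pderiv i a = 0 := by
    intro i
    have := key i
    rw [hb1, mul_zero] at this
    exact (mul_eq_zero.mp this).resolve_right hb0
  obtain ⟨a', rfl⟩ := exists_eq_C_of_pderiv_eq_zero ha1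
  obtain ⟨b', rfl⟩ := exists_eq_C_of_pderiv_eq_zero hb1
  exact ⟨a' / b', map_div₀ ((algebraMap (MvPolynomial (Fin n) ℂ) K).comp MvPolynomial.C) a' b'⟩

/-- The constants of the rational function field are the complex numbers. -/
theorem hasComplexConstants_ratField (n : ℕ) : HasComplexConstants n (RatField n) :=
  ⟨_, fun _ hc => exists_complex_of_fracPd_eq_zero (RatField n) hc⟩

end RationalConstants

/-! ### Extending derivations to fraction fields -/

section FractionField

variable {A K : Type*} [CommRing A] [IsDomain A] [Field K] [Algebra A K] [IsFractionRing A K]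

/-- The ring homomorphism `a ↦ a + ε d(a)` into the dual numbers over the fraction field. -/
def derivationDualHom (K : Type*) [Field K] [Algebra A K] (d : Derivation ℤ A A) :
    A →+* TrivSqZeroExt K K where
  toFun a := TrivSqZeroExt.inl (algebraMap A K a) + TrivSqZeroExt.inr (algebraMap A K (d a))
  map_one' := by ext <;> simp
  map_zero' := by ext <;> simp
  map_add' p q := by ext <;> simp only [map_add, TrivSqZeroExt.fst_add, TrivSqZeroExt.snd_add,
    TrivSqZeroExt.fst_inl, TrivSqZeroExt.snd_inl, TrivSqZeroExt.fst_inr, TrivSqZeroExt.snd_inr,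
    add_zero, zero_add]
  map_mul' p q := by
    ext
    · simp
    · simp only [Derivation.leibniz, smul_eq_mul, map_add, map_mul, TrivSqZeroExt.snd_add,
        TrivSqZeroExt.snd_inl, TrivSqZeroExt.snd_inr, zero_add, TrivSqZeroExt.snd_mul,
        TrivSqZeroExt.fst_add, TrivSqZeroExt.fst_inl, TrivSqZeroExt.fst_inr, add_zero,
        op_smul_eq_smul, smul_eq_mul]

/-- The extension of `derivationDualHom` to the fraction field. -/
def derivationDualLift (K : Type*) [Field K] [Algebra A K] [IsFractionRing A K]
    (d : Derivation ℤ A A) : K →+* TrivSqZeroExt K K :=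
  IsLocalization.lift (M := nonZeroDivisors A) (g := derivationDualHom K d) (by
    intro y
    rw [TrivSqZeroExt.isUnit_iff_isUnit_fst]
    simp [derivationDualHom])

theorem derivationDualLift_algebraMap (d : Derivation ℤ A A) (a : A) :
    derivationDualLift K d (algebraMap A K a) = derivationDualHom K d a :=
  IsLocalization.lift_eq _ a

theorem fst_derivationDualLift (d : Derivation ℤ A A) (f : K) :
    (derivationDualLift K d f).fst = f := by
  have h : ((TrivSqZeroExt.fstHom K K K).toRingHom.comp (derivationDualLift K d)) =
      RingHom.id K := by
    apply IsLocalization.ringHom_ext (nonZeroDivisors A)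
    ext x
    simp [derivationDualLift_algebraMap, derivationDualHom]
  exact congrArg (fun g => g f) h

/-- The extension of a derivation to the fraction field. -/
def fracDerivation (K : Type*) [Field K] [Algebra A K] [IsFractionRing A K]
    (d : Derivation ℤ A A) : Derivation ℤ K K :=
  Derivation.mk' (AddMonoidHom.toIntLinearMap
    { toFun := fun f => (derivationDualLift K d f).snd
      map_zero' := by simp
      map_add' := by simp })
    (by
      intro a b
      simp [fst_derivationDualLift, mul_comm])

theorem fracDerivation_algebraMap (d : Derivation ℤ A A) (a : A) :
    fracDerivation K d (algebraMap A K a) = algebraMap A K (d a) := by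
  change (derivationDualLift K d (algebraMap A K a)).snd = _
  rw [derivationDualLift_algebraMap]
  change (TrivSqZeroExt.inl _ + TrivSqZeroExt.inr _ : TrivSqZeroExt K K).snd = _
  rw [TrivSqZeroExt.snd_add, TrivSqZeroExt.snd_inl, TrivSqZeroExt.snd_inr, zero_add]

theorem fracDerivation_comm {d d' : Derivation ℤ A A} (h : ∀ a, d (d' a) = d' (d a)) (f : K) :
    fracDerivation K d (fracDerivation K d' f) = fracDerivation K d' (fracDerivation K d f) := by
  have h0 : ⁅fracDerivation K d, fracDerivation K d'⁆ f = 0 := by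
    obtain ⟨p, q, -, rfl⟩ := IsFractionRing.div_surjective (A := A) f
    have key : ∀ p : A, ⁅fracDerivation K d, fracDerivation K d'⁆ (algebraMap A K p) = 0 := by
      intro p
      simp [Derivation.commutator_apply, fracDerivation_algebraMap, h p]
    rw [Derivation.leibniz_div]
    simp [key]
  simpa [Derivation.commutator_apply, sub_eq_zero] using h0

end FractionField

/-! ### Differential structures on F(X) -/

section RatFuncDiff

variable {n : ℕ} {F : Type*} [Field F] [PartialDiff n F]

/-- The derivation of `F[X]` extending `∂ᵢ` with `X ↦ v`. -/
def polyPd (v : F[X]) (i : Fin n) : Derivation ℤ F[X] F[X] :=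
  coeffDeriv (pd i) + v • (derivative' : Derivation F F[X] F[X]).restrictScalars ℤ

theorem polyPd_apply (v : F[X]) (i : Fin n) (p : F[X]) :
    polyPd v i p = coeffDeriv (pd i) p + v * derivative p := rfl

@[simp]
theorem polyPd_C (v : F[X]) (i : Fin n) (a : F) : polyPd v i (C a) = C (pd i a) := by
  rw [polyPd_apply, derivative_C, mul_zero, add_zero]
  ext k
  rw [coeff_coeffDeriv, coeff_C, coeff_C]
  split_ifs <;> simp

@[simp]
theorem polyPd_X (v : F[X]) (i : Fin n) : polyPd v i X = v := by
  have h : coeffDeriv (pd i) (X : F[X]) = 0 := by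
    ext k
    rw [coeff_coeffDeriv, coeff_X]
    split_ifs <;> simp
  rw [polyPd_apply, h, derivative_X, mul_one, zero_add]

/-- The commutator is a derivation that vanishes on constant polynomials and, by `hv`, on X. -/
theorem polyPd_comm {v : Fin n → F[X]} (hv : ∀ i j, polyPd (v i) i (v j) = polyPd (v j) j (v i))
    (i j : Fin n) (p : F[X]) :
    polyPd (v i) i (polyPd (v j) j p) = polyPd (v j) j (polyPd (v i) i p) := by
  have h0 : ⁅polyPd (v i) i, polyPd (v j) j⁆ p = 0 := by
    induction p using Polynomial.induction_on' with
    | add p q hp hq => rw [map_add, hp, hq, add_zero]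
    | monomial k a =>
      rw [← C_mul_X_pow_eq_monomial, Derivation.leibniz, Derivation.leibniz_pow]
      simp [Derivation.commutator_apply, hv i j, PartialDiff.pd_comm i j]
  simpa [Derivation.commutator_apply, sub_eq_zero] using h0

/-- The derivations of `F(X)` extending those of `F` with `∂ᵢ X = vᵢ`. -/
@[reducible]
def ratFuncPartialDiff (v : Fin n → F[X])
    (hv : ∀ i j, polyPd (v i) i (v j) = polyPd (v j) j (v i)) : PartialDiff n (RatFunc F) where
  pd i := fracDerivation (RatFunc F) (polyPd (v i) i)
  pd_comm i j a := fracDerivation_comm (polyPd_comm hv i j) a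

variable (v : Fin n → F[X]) (hv : ∀ i j, polyPd (v i) i (v j) = polyPd (v j) j (v i))

theorem ratFunc_pd_algebraMap (i : Fin n) (p : F[X]) :
    letI := ratFuncPartialDiff v hv
    pd i (algebraMap F[X] (RatFunc F) p) = algebraMap F[X] (RatFunc F) (polyPd (v i) i p) :=
  fracDerivation_algebraMap _ _

theorem ratFunc_isDiffExtension :
    letI := ratFuncPartialDiff v hv
    IsDiffExtension n F (RatFunc F) := by
  let := ratFuncPartialDiff v hv
  refine ⟨fun i a => ?_⟩
  have h : ∀ a : F, algebraMap F (RatFunc F) a = algebraMap F[X] (RatFunc F) (C a) := fun a =>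
    IsScalarTower.algebraMap_apply F F[X] (RatFunc F) a
  rw [h, h, ratFunc_pd_algebraMap, polyPd_C]

theorem polyPd_num_mul_denom {f : RatFunc F}
    (hf : letI := ratFuncPartialDiff v hv; ∀ i : Fin n, pd i f = 0) (i : Fin n) :
    polyPd (v i) i f.num * f.denom = f.num * polyPd (v i) i f.denom := by
  let := ratFuncPartialDiff v hv
  refine derivation_mul_eq_of_div_eq_zero (K := RatFunc F) (D := pd i)
    (ratFunc_pd_algebraMap v hv i) f.denom_ne_zero ?_
  rw [RatFunc.num_div_denom]
  exact hf i

end RatFuncDiff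

/-! ### Adjoining an integral -/

section Primitive

universe u

variable {n : ℕ} {F : Type u} [Field F] [PartialDiff n F]

theorem coeff_polyPd_C (b : F) (i : Fin n) (p : F[X]) (k : ℕ) :
    (polyPd (C b) i p).coeff k = pd i (p.coeff k) + b * (p.coeff (k + 1) * (k + 1)) := by
  rw [polyPd_apply, coeff_add, coeff_coeffDeriv, coeff_C_mul, coeff_derivative]

/-- A constant polynomial for the derivation with `X ↦ β`, where `β` is not exact, has degree
zero. -/
theorem natDegree_eq_zero_of_polyPd_C [CharZero F] {β : Fin n → F} (hβ : ¬ ∃ b : F, ∀ i, pd i b = β i)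
    {p : F[X]} (hp : ∀ i, polyPd (C (β i)) i p = 0) : p.natDegree = 0 := by
  by_contra h0
  obtain ⟨k, hk⟩ := Nat.exists_eq_succ_of_ne_zero h0
  have hp0 : p ≠ 0 := fun h => by simp [h] at h0
  have hlead : p.coeff (k + 1) ≠ 0 := by
    rw [← Nat.succ_eq_add_one, ← hk]
    exact leadingCoeff_ne_zero.mpr hp0
  have hk1 : (k + 1 : F) ≠ 0 := Nat.cast_add_one_ne_zero k
  -- The top two coefficients of ∂p = 0 say that the leading one is constant and that ∂pₖ =
  -- -(k+1)·pₖ₊₁·β, so this quotient integrates β.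
  refine hβ ⟨-(p.coeff k) / (p.coeff (k + 1) * (k + 1)), fun i => ?_⟩
  have h1 : pd i (p.coeff (k + 1)) = 0 := by
    have := congrArg (fun q => coeff q (k + 1)) (hp i)
    simp only [coeff_polyPd_C, coeff_zero] at this
    rwa [coeff_eq_zero_of_natDegree_lt (by omega : p.natDegree < k + 1 + 1), zero_mul, mul_zero,
      add_zero] at this
  have h2 : pd i (p.coeff k) + β i * (p.coeff (k + 1) * (k + 1)) = 0 := by
    have := congrArg (fun q => coeff q k) (hp i)
    simpa only [coeff_polyPd_C, coeff_zero] using this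
  have h3 : pd i (p.coeff (k + 1) * (k + 1) : F) = 0 := by
    rw [Derivation.leibniz, h1]
    have h4 : (k + 1 : F) = ((k + 1 : ℕ) : F) := by push_cast; rfl
    rw [h4, Derivation.map_natCast, smul_zero, smul_zero, add_zero]
  rw [pd_div _ _ _ (mul_ne_zero hlead hk1), h3, zero_div, mul_zero, zero_div, sub_zero, map_neg,
    div_eq_iff (mul_ne_zero hlead hk1)]
  linear_combination -h2

theorem polyPd_C_comm {β : Fin n → F} (hβ : ∀ i j, pd i (β j) = pd j (β i)) (i j : Fin n) :
    polyPd (C (β i)) i (C (β j)) = polyPd (C (β j)) j (C (β i)) := by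
  rw [polyPd_C, polyPd_C, hβ]

/-- For a constant f in lowest terms, the denominator divides its derivatives, which have smaller
degree since it is monic. So it is a constant, and then so is the numerator; non-exactness forces
both to have degree zero. -/
theorem ratFunc_sameConstants_of_not_exact [CharZero F] {β : Fin n → F}
    (hclosed : ∀ i j, pd i (β j) = pd j (β i)) (hβ : ¬ ∃ b : F, ∀ i, pd i b = β i) :
    letI := ratFuncPartialDiff (fun i => C (β i)) (polyPd_C_comm hclosed)
    SameConstants n F (RatFunc F) := by
  let := ratFuncPartialDiff (fun i => C (β i)) (polyPd_C_comm hclosed)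
  have := ratFunc_isDiffExtension (fun i => C (β i)) (polyPd_C_comm hclosed)
  intro f hf
  have key := polyPd_num_mul_denom _ (polyPd_C_comm hclosed) hf
  have hdenom : ∀ i, polyPd (C (β i)) i f.denom = 0 := by
    intro i
    by_contra hne
    have hdvd : f.denom ∣ polyPd (C (β i)) i f.denom :=
      f.isCoprime_num_denom.symm.dvd_of_dvd_mul_left ⟨_, (key i).symm.trans (mul_comm _ _)⟩
    refine absurd (degree_le_of_dvd hdvd hne) (not_le.mpr ?_)
    rw [degree_eq_natDegree f.denom_ne_zero, degree_lt_iff_coeff_zero]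
    intro m hm
    rw [coeff_polyPd_C, coeff_eq_zero_of_natDegree_lt (by omega : f.denom.natDegree < m + 1)]
    rcases hm.eq_or_lt with rfl | hm
    · rw [f.monic_denom.coeff_natDegree, Derivation.map_one_eq_zero]
      simp
    · rw [coeff_eq_zero_of_natDegree_lt hm]
      simp
  have hd1 : f.denom = 1 :=
    f.monic_denom.natDegree_eq_zero.mp (natDegree_eq_zero_of_polyPd_C hβ hdenom)
  have hnum : ∀ i, polyPd (C (β i)) i f.num = 0 := by
    intro i
    have := key i
    rwa [hdenom, mul_zero, hd1, mul_one] at this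
  have hf' : algebraMap F (RatFunc F) (f.num.coeff 0) = f := by
    conv_rhs => rw [← RatFunc.num_div_denom f, hd1, map_one, div_one,
      eq_C_of_natDegree_eq_zero (natDegree_eq_zero_of_polyPd_C hβ hnum)]
    exact IsScalarTower.algebraMap_apply F F[X] (RatFunc F) _
  refine ⟨f.num.coeff 0, fun i => (algebraMap F (RatFunc F)).injective ?_, hf'⟩
  rw [← IsDiffExtension.pd_algebraMap, hf', hf, map_zero]

/-- A closed one-form has an integral in an extension without new constants. -/
theorem exists_integral [CharZero F] {β : Fin n → F} (hβ : ∀ i j, pd i (β j) = pd j (β i)) :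
    ∃ (M : Type u) (_ : Field M) (_ : Algebra F M) (_ : PartialDiff n M) (s : M),
      IsDiffExtension n F M ∧ SameConstants n F M ∧ adjoin F {s} = ⊤ ∧
      ∀ i, pd i s = algebraMap F M (β i) := by
  -- If β = db already in F, a free variable with ∂X = β would create the new constant X - b.
  by_cases h : ∃ b : F, ∀ i, pd i b = β i
  · obtain ⟨b, hb⟩ := h
    refine ⟨F, inferInstance, inferInstance, inferInstance, b, ⟨fun _ _ => rfl⟩,
      fun c hc => ⟨c, hc, rfl⟩, ?_, hb⟩
    rw [eq_top_iff]
    exact fun x _ => IntermediateField.algebraMap_mem (adjoin F {b}) x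
  · let := ratFuncPartialDiff (fun i => C (β i)) (polyPd_C_comm hβ)
    refine ⟨RatFunc F, inferInstance, inferInstance, inferInstance, RatFunc.X,
      ratFunc_isDiffExtension _ (polyPd_C_comm hβ), ratFunc_sameConstants_of_not_exact hβ h,
      RatFunc.adjoin_X, fun i => ?_⟩
    rw [← RatFunc.algebraMap_X, ratFunc_pd_algebraMap _ (polyPd_C_comm hβ), polyPd_X]
    exact (IsScalarTower.algebraMap_apply F F[X] (RatFunc F) _).symm

end Primitive

/-! ### Adjoining the exponential of an integral -/

section Exponential

universe u

variable {n : ℕ} {F : Type u} [Field F] [PartialDiff n F]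

theorem coeff_polyPd_C_mul_X (a : F) (i : Fin n) (p : F[X]) (k : ℕ) :
    (polyPd (C a * X) i p).coeff k = pd i (p.coeff k) + k * a * p.coeff k := by
  rw [polyPd_apply, coeff_add, coeff_coeffDeriv, mul_assoc, coeff_C_mul]
  cases k with
  | zero => simp
  | succ k =>
    rw [coeff_X_mul, coeff_derivative]
    push_cast
    ring

theorem polyPd_C_mul_X_comm {α : Fin n → F} (hα : ∀ i j, pd i (α j) = pd j (α i)) (i j : Fin n) :
    polyPd (C (α i) * X) i (C (α j) * X) = polyPd (C (α j) * X) j (C (α i) * X) := by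
  rw [Derivation.leibniz, Derivation.leibniz, polyPd_C, polyPd_C, polyPd_X, polyPd_X, hα]
  simp only [smul_eq_mul]
  ring

/-- Passing to 1/u changes the sign of the exponent, so positive exponents suffice. -/
theorem eq_zero_of_pd_eq_intCast_mul {α : Fin n → F}
    (hα : ∀ N : ℕ, N ≠ 0 → ∀ u : F, (∀ i, pd i u = N * α i * u) → u = 0) (m : ℤ) (hm : m ≠ 0)
    (u : F) (hu : ∀ i, pd i u = m * α i * u) : u = 0 := by
  rcases le_total 0 m with h | h
  · obtain ⟨N, rfl⟩ := Int.eq_ofNat_of_zero_le h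
    exact hα N (by exact_mod_cast hm) u (by simpa using hu)
  · obtain ⟨N, hN⟩ := Int.eq_ofNat_of_zero_le (neg_nonneg.mpr h)
    have hN' : m = -(N : ℤ) := by omega
    subst hN'
    by_contra hu0
    refine inv_ne_zero hu0 (hα N (by simpa using hm) u⁻¹ fun i => ?_)
    rw [Derivation.leibniz_inv, hu]
    push_cast
    simp only [smul_eq_mul]
    field_simp

/-- A polynomial dividing its derivatives for `X ↦ αᵢ X` is a monomial, unless a multiple of `α`
is a logarithmic differential. -/
theorem exists_eq_monomial_of_dvd_polyPd {α : Fin n → F}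
    (hα : ∀ N : ℕ, N ≠ 0 → ∀ u : F, (∀ i, pd i u = N * α i * u) → u = 0) {p : F[X]} (hp0 : p ≠ 0)
    (hp : ∀ i, p ∣ polyPd (C (α i) * X) i p) : ∃ (d : ℕ) (c : F), c ≠ 0 ∧ p = C c * X ^ d := by
  have hl : ∀ i, ∃ l : F, ∀ k, pd i (p.coeff k) + k * α i * p.coeff k = l * p.coeff k := by
    intro i
    obtain ⟨r, hr⟩ := hp i
    -- The derivation does not raise degrees, so the cofactor r is a scalar l and every coefficient
    -- satisfies its own first-order equation.
    have hr0 : r.natDegree = 0 := by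
      rcases eq_or_ne r 0 with rfl | hr0
      · simp
      · have h1 : (polyPd (C (α i) * X) i p).natDegree ≤ p.natDegree := by
          rw [natDegree_le_iff_coeff_eq_zero]
          intro m hm
          rw [coeff_polyPd_C_mul_X, coeff_eq_zero_of_natDegree_lt hm]
          simp
        rw [hr, natDegree_mul hp0 hr0] at h1
        omega
    refine ⟨r.coeff 0, fun k => ?_⟩
    rw [← coeff_polyPd_C_mul_X, hr, eq_C_of_natDegree_eq_zero hr0, coeff_mul_C, coeff_C_zero,
      mul_comm]
  choose l hl using hl
  refine ⟨p.natDegree, p.leadingCoeff, leadingCoeff_ne_zero.mpr hp0, ?_⟩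
  ext k
  rw [coeff_C_mul, coeff_X_pow]
  split_ifs with hk
  · rw [hk, mul_one]
    rfl
  · rw [mul_zero]
    have hlead : p.coeff p.natDegree ≠ 0 := leadingCoeff_ne_zero.mpr hp0
    -- The factor l cancels in the ratio of the k-th coefficient to the leading one, which solves ∂u
    -- = (deg p - k)·α·u.
    have h1 := eq_zero_of_pd_eq_intCast_mul hα ((p.natDegree : ℤ) - k)
      (by omega) (p.coeff k / p.coeff p.natDegree) (fun i => by
        have h2 := hl i k
        have h3 := hl i p.natDegree
        rw [pd_div _ _ _ hlead, eq_sub_of_add_eq h2, eq_sub_of_add_eq h3]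
        push_cast
        field_simp
        ring)
    exact (div_eq_zero_iff.mp h1).resolve_right hlead

/-- The numerator and denominator of a constant each divide their derivatives, so both are
monomials. Their quotient is (a/b)·X^(e-d), and its constancy makes a/b a solution of exponent d -
e, which forces d = e. -/
theorem ratFunc_sameConstants_of_not_logarithmic {α : Fin n → F}
    (hclosed : ∀ i j, pd i (α j) = pd j (α i))
    (hα : ∀ N : ℕ, N ≠ 0 → ∀ u : F, (∀ i, pd i u = N * α i * u) → u = 0) :
    letI := ratFuncPartialDiff (fun i => C (α i) * X) (polyPd_C_mul_X_comm hclosed)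
    SameConstants n F (RatFunc F) := by
  let := ratFuncPartialDiff (fun i => C (α i) * X) (polyPd_C_mul_X_comm hclosed)
  have := ratFunc_isDiffExtension (fun i => C (α i) * X) (polyPd_C_mul_X_comm hclosed)
  intro f hf
  have key := polyPd_num_mul_denom _ (polyPd_C_mul_X_comm hclosed) hf
  rcases eq_or_ne f 0 with rfl | hf0
  · exact ⟨0, fun i => map_zero _, map_zero _⟩
  have hnum0 : f.num ≠ 0 := RatFunc.num_ne_zero hf0
  obtain ⟨d, b, hb0, hb⟩ := exists_eq_monomial_of_dvd_polyPd hα f.denom_ne_zero fun i =>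
    f.isCoprime_num_denom.symm.dvd_of_dvd_mul_left ⟨_, (key i).symm.trans (mul_comm _ _)⟩
  obtain ⟨e, a, ha0, ha⟩ := exists_eq_monomial_of_dvd_polyPd hα hnum0 fun i =>
    f.isCoprime_num_denom.dvd_of_dvd_mul_right ⟨_, key i⟩
  have hmono : ∀ (i : Fin n) (c : F) (k : ℕ),
      polyPd (C (α i) * X) i (C c * X ^ k) = C (pd i c + k * α i * c) * X ^ k := by
    intro i c k
    ext m
    rw [coeff_polyPd_C_mul_X, coeff_C_mul, coeff_C_mul, coeff_X_pow]
    split_ifs with h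
    · rw [h, mul_one, mul_one]
    · simp
  have hu : ∀ i, pd i (a / b) = ((d : ℤ) - (e : ℤ) : ℤ) * α i * (a / b) := by
    intro i
    have h1 := key i
    rw [ha, hb, hmono, hmono] at h1
    have h2 : C ((pd i a + e * α i * a) * b - a * (pd i b + d * α i * b)) * X ^ (e + d) = 0 := by
      rw [C_sub, C_mul, C_mul, pow_add]
      linear_combination h1
    have h3 : (pd i a + e * α i * a) * b - a * (pd i b + d * α i * b) = 0 :=
      C_eq_zero.mp ((mul_eq_zero.mp h2).resolve_right (pow_ne_zero _ X_ne_zero))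
    rw [pd_div _ _ _ hb0]
    push_cast
    field_simp
    linear_combination h3
  have hde : d = e := by
    by_contra hne
    refine div_ne_zero ha0 hb0 (eq_zero_of_pd_eq_intCast_mul hα _ ?_ _ hu)
    omega
  have hf' : algebraMap F (RatFunc F) (a / b) = f := by
    have hX : algebraMap F[X] (RatFunc F) (X ^ d) ≠ 0 := by simp [RatFunc.X_ne_zero]
    conv_rhs => rw [← RatFunc.num_div_denom f, ha, hb, ← hde, map_mul, map_mul,
      mul_div_mul_right _ _ hX]
    rw [map_div₀, IsScalarTower.algebraMap_apply F F[X] (RatFunc F),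
      IsScalarTower.algebraMap_apply F F[X] (RatFunc F)]
    rfl
  refine ⟨a / b, fun i => (algebraMap F (RatFunc F)).injective ?_, hf'⟩
  rw [← IsDiffExtension.pd_algebraMap, hf', hf, map_zero]

/-- The derivations extend to finite extensions. -/
theorem exists_partialDiff_of_finiteDimensional [CharZero F] (E : Type*) [Field E] [Algebra F E]
    [FiniteDimensional F E] : ∃ _ : PartialDiff n E, IsDiffExtension n F E := by
  have h : ∀ i : Fin n, ∃ D : Derivation ℤ E E,
      ∀ a, D (algebraMap F E a) = algebraMap F E (pd i a) := by
    intro i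
    let : Differential F := ⟨pd i⟩
    let := Differential.differentialFiniteDimensional F E
    have := Differential.differentialAlgebraFiniteDimensional (F := F) (K := E)
    exact ⟨Differential.deriv, DifferentialAlgebra.deriv_algebraMap⟩
  choose D hD using h
  refine ⟨{ pd := D, pd_comm := fun i j a => ?_ }, @IsDiffExtension.mk _ _ _ _ _ _ _ (_) hD⟩
  have h0 : ⁅D i, D j⁆ a = (0 : Derivation ℤ E E) a :=
    derivation_eq_of_isAlgebraic (F := F)
      (fun a => by simp [Derivation.commutator_apply, hD, PartialDiff.pd_comm i j])
      (Algebra.IsAlgebraic.isAlgebraic a)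
  simpa [Derivation.commutator_apply, sub_eq_zero] using h0

/-- A closed one-form has an exponential of an integral in an extension without new constants. -/
theorem exists_exponential [CharZero F] (hF : HasComplexConstants n F) {α : Fin n → F}
    (hα : ∀ i j, pd i (α j) = pd j (α i)) :
    ∃ (M : Type u) (_ : Field M) (_ : Algebra F M) (_ : PartialDiff n M) (e : M),
      IsDiffExtension n F M ∧ SameConstants n F M ∧ adjoin F {e} = ⊤ ∧ e ≠ 0 ∧
      ∀ i, pd i e = e * algebraMap F M (α i) := by
  -- If ∂u = Nαu with u ≠ 0, a free exponential X would create the new constant X^N/u; an N-th root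
  -- of u is then the exponential.
  by_cases h : ∀ N : ℕ, N ≠ 0 → ∀ u : F, (∀ i, pd i u = N * α i * u) → u = 0
  · let := ratFuncPartialDiff (fun i => C (α i) * X) (polyPd_C_mul_X_comm hα)
    refine ⟨RatFunc F, inferInstance, inferInstance, inferInstance, RatFunc.X,
      ratFunc_isDiffExtension _ (polyPd_C_mul_X_comm hα),
      ratFunc_sameConstants_of_not_logarithmic hα h,
      RatFunc.adjoin_X, RatFunc.X_ne_zero, fun i => ?_⟩
    rw [← RatFunc.algebraMap_X, ratFunc_pd_algebraMap _ (polyPd_C_mul_X_comm hα), polyPd_X,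
      map_mul, mul_comm]
    congr 1
  · push Not at h
    obtain ⟨N, hN, u, hu, hu0⟩ := h
    obtain ⟨r, hr⟩ := IsAlgClosed.exists_pow_nat_eq
      (algebraMap F (AlgebraicClosure F) u) (Nat.pos_of_ne_zero hN)
    have hint : IsIntegral F r := Algebra.IsIntegral.isIntegral r
    have := adjoin.finiteDimensional hint
    obtain ⟨_, _⟩ := exists_partialDiff_of_finiteDimensional (n := n) (F := F) F⟮r⟯
    let e : F⟮r⟯ := AdjoinSimple.gen F r
    have he : e ^ N = algebraMap F F⟮r⟯ u := Subtype.ext hr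
    have he0 : e ≠ 0 := by
      intro h0
      rw [h0, zero_pow hN] at he
      exact hu0 ((map_eq_zero _).mp he.symm)
    refine ⟨F⟮r⟯, inferInstance, inferInstance, inferInstance, e, inferInstance,
      sameConstants_of_isAlgebraic hF, ?_, he0, fun i => ?_⟩
    · apply lift_injective
      rw [lift_adjoin_simple, lift_top]
      rfl
    · have : CharZero F⟮r⟯ := charZero_of_injective_algebraMap (algebraMap F F⟮r⟯).injective
      have hN' : (N : F⟮r⟯) ≠ 0 := Nat.cast_ne_zero.mpr hN
      -- Differentiating e^N = u gives N·e^(N-1)·∂e = N·α·e^N, from which N·e^(N-1) is cancelled.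
      have h1 := congrArg (pd i) he
      rw [IsDiffExtension.pd_algebraMap, hu, map_mul, map_mul, ← he, map_natCast,
        Derivation.leibniz_pow] at h1
      simp only [smul_eq_mul, nsmul_eq_mul] at h1
      obtain ⟨k, rfl⟩ := Nat.exists_eq_succ_of_ne_zero hN
      rw [Nat.succ_sub_one, Nat.succ_eq_add_one, pow_succ] at h1
      have h2 : ((k + 1 : ℕ) : F⟮r⟯) * e ^ k ≠ 0 := mul_ne_zero hN' (pow_ne_zero k he0)
      apply mul_left_cancel₀ h2
      linear_combination h1

end Exponential

/-! ### Towers of abstract extensions as Liouvillian towers -/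

section LiouvillianTower

theorem SameConstants.trans {n : ℕ} {K E M : Type*} [Field K] [Field E] [Field M] [Algebra K E]
    [Algebra E M] [Algebra K M] [IsScalarTower K E M] [PartialDiff n K] [PartialDiff n E]
    [PartialDiff n M] (h : SameConstants n K E) (h' : SameConstants n E M) :
    SameConstants n K M := by
  intro c hc
  obtain ⟨b, hb, rfl⟩ := h' c hc
  obtain ⟨a, ha, rfl⟩ := h b hb
  exact ⟨a, ha, IsScalarTower.algebraMap_apply K E M a⟩

variable (n : ℕ) (K A B M : Type*) [Field K] [Field A] [Field B] [Field M] [Algebra K A]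
  [Algebra K B] [Algebra K M] [Algebra A B] [Algebra A M] [Algebra B M]
  [IsScalarTower K A M] [IsScalarTower K B M] [IsScalarTower A B M]

/-- The image of an intermediate step of a tower of fields, as an intermediate field. -/
def towerField : IntermediateField K M := (IsScalarTower.toAlgHom K A M).fieldRange

theorem mem_towerField {x : M} : x ∈ towerField K A M ↔ ∃ a, algebraMap A M a = x :=
  AlgHom.mem_fieldRange

theorem towerField_self : towerField K K M = ⊥ := by
  ext x
  rw [mem_towerField, mem_bot]
  rfl

theorem towerField_top : towerField K M M = ⊤ := by
  rw [eq_top_iff]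
  exact fun x _ => (mem_towerField K M M).mpr ⟨x, rfl⟩

variable {B} in
-- Liouvillian steps refer to intermediate fields of one top field, while the extensions are built
-- one over another; this transports generation of B over A by t to the images in M.
theorem towerField_eq_adjoin {t : B} (ht : adjoin A {t} = ⊤) :
    towerField K B M =
      (adjoin (towerField K A M) {algebraMap B M t}).restrictScalars K := by
  ext x
  rw [mem_towerField, mem_restrictScalars]
  constructor
  · rintro ⟨b, rfl⟩
    have hb : b ∈ adjoin A {t} := by
      rw [ht]
      exact mem_top
    induction hb using adjoin_induction with
    | mem x hx =>
      rw [Set.mem_singleton_iff] at hx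
      subst hx
      exact mem_adjoin_simple_self _ _
    | algebraMap a =>
      rw [← IsScalarTower.algebraMap_apply]
      exact IntermediateField.algebraMap_mem (adjoin (towerField K A M) {algebraMap B M t})
        (⟨algebraMap A M a, (mem_towerField K A M).mpr ⟨a, rfl⟩⟩ : towerField K A M)
    | add x y _ _ hx hy => rw [map_add]; exact add_mem hx hy
    | inv x _ hx => rw [map_inv₀]; exact inv_mem hx
    | mul x y _ _ hx hy => rw [map_mul]; exact mul_mem hx hy
  · intro hx
    induction hx using adjoin_induction with
    | mem x hx =>
      rw [Set.mem_singleton_iff] at hx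
      exact ⟨t, hx.symm⟩
    | algebraMap a =>
      obtain ⟨a, ha⟩ := a
      obtain ⟨a, rfl⟩ := (mem_towerField K A M).mp ha
      exact ⟨algebraMap A B a, (IsScalarTower.algebraMap_apply A B M a).symm⟩
    | add x y _ _ hx hy =>
      obtain ⟨x, rfl⟩ := hx
      obtain ⟨y, rfl⟩ := hy
      exact ⟨x + y, map_add _ _ _⟩
    | inv x _ hx =>
      obtain ⟨x, rfl⟩ := hx
      exact ⟨x⁻¹, map_inv₀ _ _⟩
    | mul x y _ _ hx hy =>
      obtain ⟨x, rfl⟩ := hx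
      obtain ⟨y, rfl⟩ := hy
      exact ⟨x * y, map_mul _ _ _⟩

variable {B} in
theorem isLiouvillianStep_towerField [PartialDiff n K] [PartialDiff n B] [PartialDiff n M]
    [IsDiffExtension n B M] {t : B} (ht : adjoin A {t} = ⊤)
    (hstep : (t ≠ 0 ∧ ∀ i : Fin n, ∃ a : A, pd i t = t * algebraMap A B a) ∨
      (∀ i : Fin n, ∃ a : A, pd i t = algebraMap A B a) ∨ IsAlgebraic A t) :
    IsLiouvillianStep n K M (towerField K A M) (towerField K B M) := by
  refine ⟨algebraMap B M t, towerField_eq_adjoin K A M ht, ?_⟩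
  have hA : ∀ a : A, algebraMap B M (algebraMap A B a) ∈ towerField K A M := fun a =>
    (mem_towerField K A M).mpr ⟨a, IsScalarTower.algebraMap_apply A B M a⟩
  rcases hstep with ⟨h0, hstep⟩ | hstep | hstep
  · refine Or.inl ⟨(map_ne_zero (algebraMap B M)).mpr h0, fun i => ?_⟩
    obtain ⟨a, ha⟩ := hstep i
    rw [IsDiffExtension.pd_algebraMap, ha, ← map_div₀, mul_div_cancel_left₀ _ h0]
    exact hA a
  · refine Or.inr (Or.inl fun i => ?_)
    obtain ⟨a, ha⟩ := hstep i
    rw [IsDiffExtension.pd_algebraMap, ha]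
    exact hA a
  · refine Or.inr (Or.inr ?_)
    have hmem : ∀ a : A, algebraMap A M a ∈ towerField K A M := fun a =>
      (mem_towerField K A M).mpr ⟨a, rfl⟩
    refine hstep.ringHom_of_comp_eq ((algebraMap A M).codRestrict (towerField K A M) hmem)
      (algebraMap B M) (RingHom.injective _) ?_
    ext a
    exact IsScalarTower.algebraMap_apply A B M a

end LiouvillianTower

/-- The function e is an integrating factor: de = eα turns dω = α ∧ ω into d(ω/e) = 0, so ω/e can be
integrated. -/
theorem IsIntegrablePair.pd_div_comm {n : ℕ} {E : Type*} [Field E] [PartialDiff n E]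
    {P ω α : Fin n → E} (hp : IsIntegrablePair P ω α) {e : E} (he0 : e ≠ 0)
    (he : ∀ i, pd i e = e * α i) (i j : Fin n) :
    pd i (ω j * e⁻¹) = pd j (ω i * e⁻¹) := by
  have h := hp.d_fst i j
  rw [← div_eq_mul_inv, ← div_eq_mul_inv, pd_div _ _ _ he0, pd_div _ _ _ he0, he, he]
  field_simp
  linear_combination h

/-- An integrable pair over a finite extension of `K` gives a first integral `∫ ω exp (-∫ α)` in
a Liouvillian extension of `K`. -/
theorem IsIntegrablePair.exists_firstIntegral.{u, v} {n : ℕ} {K : Type u} {E : Type v} [Field K]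
    [CharZero K] [Field E] [Algebra K E] [PartialDiff n K] [PartialDiff n E] [IsDiffExtension n K E]
    [FiniteDimensional K E] (hK : HasComplexConstants n K) {P ω α : Fin n → E}
    (hp : IsIntegrablePair P ω α) :
    ∃ (M : Type v) (_ : Field M) (_ : Algebra K M) (_ : Algebra E M) (_ : PartialDiff n M)
      (e s : M), IsScalarTower K E M ∧ IsDiffExtension n E M ∧ e ≠ 0 ∧
        (∀ i, pd i e = e * algebraMap E M (α i)) ∧ (∀ i, pd i s = algebraMap E M (ω i) * e⁻¹) ∧
        IsLiouvillianExtension n K M := by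
  have : CharZero E := charZero_of_injective_algebraMap (algebraMap K E).injective
  have hKE : SameConstants n K E := sameConstants_of_isAlgebraic hK
  obtain ⟨M₁, _, _, _, e, _, hEM₁, htop₁, he0, he⟩ :=
    exists_exponential (hK.of_sameConstants hKE) hp.d_snd
  have : CharZero M₁ := charZero_of_injective_algebraMap (algebraMap E M₁).injective
  have hp₁ := hp.map (algebraMap E M₁) IsDiffExtension.pd_algebraMap
  obtain ⟨M, _, _, _, s, _, hM₁M, htop, hs⟩ := exists_integral (hp₁.pd_div_comm he0 he)
  let : Algebra E M := ((algebraMap M₁ M).comp (algebraMap E M₁)).toAlgebra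
  let : Algebra K M₁ := ((algebraMap E M₁).comp (algebraMap K E)).toAlgebra
  let : Algebra K M := ((algebraMap E M).comp (algebraMap K E)).toAlgebra
  have : IsScalarTower E M₁ M := IsScalarTower.of_algebraMap_eq fun _ => rfl
  have : IsScalarTower K E M₁ := IsScalarTower.of_algebraMap_eq fun _ => rfl
  have : IsScalarTower K E M := IsScalarTower.of_algebraMap_eq fun _ => rfl
  have : IsScalarTower K M₁ M := IsScalarTower.of_algebraMap_eq fun _ => rfl
  have : IsDiffExtension n E M := IsDiffExtension.trans (E := M₁)
  have : IsDiffExtension n M M := ⟨fun _ _ => rfl⟩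
  -- A primitive element makes K ⊆ E a single algebraic step; the tower is K ⊆ E ⊆ E(e) ⊆ E(e, s).
  obtain ⟨b, hb⟩ := Field.exists_primitive_element K E
  refine ⟨M, inferInstance, inferInstance, inferInstance, inferInstance, algebraMap M₁ M e, s,
    inferInstance, inferInstance, (map_ne_zero (algebraMap M₁ M)).mpr he0, fun i => ?_, fun i => ?_,
    IsDiffExtension.trans (E := E), hKE.trans (hEM₁.trans hM₁M), 3, fun k => match k with
      | 0 => towerField K K M
      | 1 => towerField K E M
      | 2 => towerField K M₁ M
      | _ => towerField K M M, towerField_self K M, towerField_top K M, fun k hk => ?_⟩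
  · rw [IsDiffExtension.pd_algebraMap, he, map_mul]
    rfl
  · rw [hs, map_mul, map_inv₀]
    rfl
  · match k, hk with
    | 0, _ =>
      exact isLiouvillianStep_towerField n K K M hb
        (Or.inr (Or.inr (Algebra.IsAlgebraic.isAlgebraic b)))
    | 1, _ =>
      exact isLiouvillianStep_towerField n K E M htop₁ (Or.inl ⟨he0, fun i => ⟨α i, he i⟩⟩)
    | 2, _ =>
      exact isLiouvillianStep_towerField n K M₁ M htop (Or.inr (Or.inl fun i => ⟨_, hs i⟩))

end LiouvilleForms

end

/-! ### The theorem: descent of the pair, then construction of the first integral -/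

theorem theorem3p1 (n : ℕ) (hn : 3 ≤ n) (P : Fin n → RatField n)
    {L : Type*} [Field L] [Algebra (RatField n) L] [PartialDiff n L] (φ : L)
    (hφ : IsLiouvillianFirstIntegral P φ) :
    ∃ (K' : Type) (_ : Field K') (_ : Algebra (RatField n) K') (_ : PartialDiff n K')
      (ω α : Fin n → K'),
      FiniteDimensional (RatField n) K' ∧ IsDiffExtension n (RatField n) K' ∧
      ω ≠ 0 ∧
      oneForm ω * vectorFieldForm (fun i => algebraMap (RatField n) K' (P i)) = 0 ∧
      dOne ω = oneForm α * oneForm ω ∧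
      dOne α = 0 ∧
      -- the first integral `ψ = ∫ ω · exp (-∫ α)`, where `e = exp (∫ α)`
      ∃ (M : Type) (_ : Field M) (_ : Algebra (RatField n) M) (_ : Algebra K' M)
        (_ : PartialDiff n M) (e ψ : M),
        IsScalarTower (RatField n) K' M ∧ IsDiffExtension n K' M ∧
        e ≠ 0 ∧
        grad n e = (fun i => e * algebraMap K' M (α i)) ∧
        grad n ψ = (fun i => algebraMap K' M (ω i) * e⁻¹) ∧
        IsLiouvillianFirstIntegral P ψ := by
  have hchar : CharZero (RatField n) :=
    charZero_of_injective_algebraMap (algebraMap ℂ (RatField n)).injective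
  obtain ⟨E, _, _, _, _, _, ω, α, hp⟩ :=
    (hφ.isLiouvillian.hasAlgebraicPair
      (IsIntegrablePair.of_grad hφ.not_constant hφ.wedge_eq_zero)).exists_finiteDimensional
  have : CharZero E := charZero_of_injective_algebraMap (algebraMap (RatField n) E).injective
  obtain ⟨M, _, _, _, _, e, ψ, _, _, he0, he, hψ, hM⟩ :=
    hp.exists_firstIntegral (hasComplexConstants_ratField n)
  refine ⟨E, inferInstance, inferInstance, inferInstance, ω, α, inferInstance, inferInstance,
    hp.ne_zero, hp.oneForm_mul, hp.dOne_fst, hp.dOne_snd, M, inferInstance, inferInstance,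
    inferInstance, inferInstance, e, ψ, inferInstance, inferInstance, he0, funext he, funext hψ,
    hM, ?_, ?_⟩
  · obtain ⟨i, hi⟩ := Function.ne_iff.mp hp.ne_zero
    refine ⟨i, ?_⟩
    rw [hψ]
    exact mul_ne_zero ((map_ne_zero (algebraMap E M)).mpr hi) (inv_ne_zero he0)
  · rw [oneForm_mul_vectorFieldForm_eq_zero_iff]
    -- The gradient of ψ is ω/e, so the vector field annihilates ψ because it annihilates ω.
    have h1 := congrArg (fun x => algebraMap E M x * e⁻¹) hp.sum_mul_eq_zero
    simp only [map_sum, map_mul, map_zero, zero_mul, Finset.sum_mul] at h1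
    rw [← h1]
    refine Finset.sum_congr rfl fun i _ => ?_
    rw [IsScalarTower.algebraMap_apply (RatField n) E M]
    change PartialDiff.pd i ψ * _ = _
    rw [hψ]
    ring
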